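/- Let $S=\{1,\dots,r\}$ be an alphabet with $r\ge 2$ symbols, $L$ the set of all finite words over $S$ (including the empty one), $|\alpha|$ the length of $\alpha\in L$, and $\mathcal H=l_2(L)$ the Hilbert space with orthonormal basis $e_\alpha$, $\alpha\in L$. Let $Sub$ be a finite set of substitutions $\delta_i\to\gamma_i$ with nonempty words $\delta_i,\gamma_i$, containing with each $\delta\to\gamma$ its inverse $\gamma\to\delta$, and let $\lambda_i\in\mathbb C$ be such that $\lambda_i=\overline{\lambda_{j}}$ whenever $\delta_j=\gamma_i$, $\gamma_j=\delta_i$. For $j\ge1$ let $a_i(j)$ be the bounded operator on $\mathcal H$ with $a_i(j)e_{\tau\delta_i\rho}=e_{\tau\gamma_i\rho}$ for all words $\tau,\rho$ with $|\tau|=j-1$, and $a_i(j)e_\alpha=0$ if $\alpha$ is not of the form $\tau\delta_i\rho$ with $|\tau|=j-1$. Let $\mathcal H_N$ be the span of the $e_\alpha$ with $|\alpha|\le N$, $P_N$ the orthogonal projection onto $\mathcal H_N$, $\mathrm{Tr}_N$ the trace over $\mathcal H_N$, and $$H_N=\sum_i\sum_{j=1}^N\lambda_i\,P_Na_i(j)P_N,\qquad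 Z_N=\mathrm{Tr}_N\,e^{-\beta H_N},\qquad \langle A\rangle_{\beta,N}=Z_N^{-1}\,\mathrm{Tr}_N\!\left[A\,e^{-\beta H_N}\right].$$ The local algebra $\mathbf A^0=\bigcup_N\mathbf A_N$ is the union of the algebras $\mathbf A_N$ of operators $A$ with $A=P_NAP_N$, and the quasilocal algebra $\mathbf A$ is its norm closure. There is $\beta_0>0$ (depending only on $r$, $Sub$ and the $\lambda_i$) such that for every real $\beta$ with $|\beta|<\beta_0$: 1. $Z_N$ is real and positive for every $N$, and it grows exponentially: there is a constant $c>0$ (that is, $e^{c}>1$), with $c>1$ if $r\ge3$, such that $\log Z_N\sim cN$ as $N\to\infty$. 2. For every local $A\in\mathbf A^0$ the limit $\langle A\rangle_\beta=\lim_{N\to\infty}\langle A\rangle_{\beta,N}$ exists and equals $0$. In particular, there is no state (positive linear functional of norm one) $\omega$ on $\mathbf A$ such that $\langle A\rangle_{\beta,N}\to\omega(A)$ for all local $A$. -/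

import Mathlib

open Filter Topology Asymptotics
open scoped ComplexOrder

noncomputable section

namespace QuantumGrammar

/-- Finite words (including the empty one) over the alphabet `S` with `r` symbols. -/
abbrev Word (r : ℕ) : Type := List (Fin r)

/-- The Hilbert space `l₂(L)` of square summable functions on the set `L` of words. -/
abbrev Hilb (r : ℕ) : Type := lp (fun _ : Word r => ℂ) 2

/-- The algebra of all bounded operators on `l₂(L)`. -/
abbrev Op (r : ℕ) : Type := Hilb r →L[ℂ] Hilb r

/-- The basis vector `e_α`. -/
def e {r : ℕ} (α : Word r) : Hilb r := lp.single 2 α (1 : ℂ)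

/-- `α = τ δ ρ` and `β = τ γ ρ` for some words `τ`, `ρ` with `|τ| = j - 1`
(positions are counted from `j = 1`). -/
def IsSubst {r : ℕ} (δ γ : Word r) (j : ℕ) (α β : Word r) : Prop :=
  ∃ τ ρ : Word r, τ.length + 1 = j ∧ α = τ ++ δ ++ ρ ∧ β = τ ++ γ ++ ρ

theorem IsSubst.right_unique {r : ℕ} {δ γ : Word r} {j : ℕ} {α β β' : Word r}
    (h : IsSubst δ γ j α β) (h' : IsSubst δ γ j α β') : β = β' := by
  obtain ⟨τ, ρ, h1, h2, h3⟩ := h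
  obtain ⟨τ', ρ', h1', h2', h3'⟩ := h'
  subst h3 h3'
  have hl : τ.length = τ'.length := by omega
  rw [h2, List.append_assoc, List.append_assoc] at h2'
  obtain ⟨rfl, h4⟩ := List.append_inj h2' hl
  rw [List.append_cancel_left h4]

open Classical in
/-- Values of `a(j) φ`: the coefficient of `e_β` is the coefficient `φ(α)` of the (unique) word `α`
that the substitution `δ → γ` at place `j` turns into `β`, and `0` if there is no such `α`. -/
def substFun {r : ℕ} (δ γ : Word r) (j : ℕ) (φ : Word r → ℂ) (β : Word r) : ℂ :=
  if h : ∃ α, IsSubst δ γ j α β then φ h.choose else 0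

theorem substFun_sum_le {r : ℕ} (δ γ : Word r) (j : ℕ) (φ : Hilb r) (s : Finset (Word r)) :
    ∑ β ∈ s, ‖substFun δ γ j φ β‖ ^ (2 : ENNReal).toReal ≤ ‖φ‖ ^ (2 : ENNReal).toReal := by
  classical
  set t := s.filter (fun β => ∃ α, IsSubst δ γ j α β) with ht
  have h0 : ∑ β ∈ s, ‖substFun δ γ j φ β‖ ^ (2 : ENNReal).toReal
      = ∑ β ∈ t, ‖substFun δ γ j φ β‖ ^ (2 : ENNReal).toReal := by
    rw [ht, Finset.sum_filter_of_ne]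
    intro β _ hne
    by_contra hcon
    apply hne
    simp [substFun, hcon]
  let f : Word r → Word r := fun β =>
    if h : ∃ α, IsSubst δ γ j α β then h.choose else β
  have hf : ∀ β ∈ t, IsSubst δ γ j (f β) β := by
    intro β hβ
    have h := (Finset.mem_filter.mp hβ).2
    simp only [f, dif_pos h]
    exact h.choose_spec
  have hinj : Set.InjOn f t := by
    intro β hβ β' hβ' hbb
    have h1 := hf β hβ
    have h2 := hf β' hβ'
    rw [hbb] at h1
    exact h1.right_unique h2
  have h1 : ∑ β ∈ t, ‖substFun δ γ j φ β‖ ^ (2 : ENNReal).toReal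
      = ∑ α ∈ t.image f, ‖φ α‖ ^ (2 : ENNReal).toReal := by
    rw [Finset.sum_image hinj]
    refine Finset.sum_congr rfl fun β hβ => ?_
    have h := (Finset.mem_filter.mp hβ).2
    simp only [substFun, f, dif_pos h]
  rw [h0, h1]
  exact lp.sum_rpow_le_norm_rpow (by norm_num) φ _

/-- The quantum substitution `a(j)` of `δ → γ`: the bounded operator with `a(j) e_α = e_β` if
`α = τ δ ρ`, `β = τ γ ρ`, `|τ| = j - 1`, and `a(j) e_α = 0` if `α` is not of this form. -/
def quantumSubst {r : ℕ} (δ γ : Word r) (j : ℕ) : Op r :=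
  LinearMap.mkContinuous
    { toFun := fun φ => ⟨substFun δ γ j φ, memℓp_gen' (substFun_sum_le δ γ j φ)⟩
      map_add' := fun φ ψ => by
        ext β
        change substFun δ γ j (φ + ψ : Hilb r) β = substFun δ γ j φ β + substFun δ γ j ψ β
        by_cases h : ∃ α, IsSubst δ γ j α β <;> simp [substFun, h]
      map_smul' := fun c φ => by
        ext β
        by_cases h : ∃ α, IsSubst δ γ j α β <;> simp [substFun, h] }
    1 (fun φ => by
      rw [one_mul]
      exact lp.norm_le_of_forall_sum_le (by norm_num) (norm_nonneg _)
        (substFun_sum_le δ γ j φ))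

/-- The finite set of words of length at most `N`. -/
def words (r N : ℕ) : Finset (Word r) :=
  (List.finite_length_le (Fin r) N).toFinset

/-- The subspace `H_N` spanned by the `e_α` with `|α| ≤ N`. -/
def HilbN (r N : ℕ) : Submodule ℂ (Hilb r) :=
  Submodule.span ℂ (e '' (words r N : Set (Word r)))

instance (r N : ℕ) : FiniteDimensional ℂ (HilbN r N) :=
  FiniteDimensional.span_of_finite ℂ ((words r N).finite_toSet.image _)

/-- The orthogonal projection `P_N` onto `H_N`. -/
def P (r N : ℕ) : Op r := (HilbN r N).starProjection

theorem P_mul_P {r M N : ℕ} (h : M ≤ N) : P r M * P r N = P r M ∧ P r N * P r M = P r M := by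
  have hle : HilbN r M ≤ HilbN r N := by
    refine Submodule.span_mono (Set.image_mono ?_)
    intro α hα
    simp only [words, Set.Finite.coe_toFinset, Set.mem_ofPred_eq] at hα ⊢
    omega
  exact ⟨Submodule.starProjection_comp_starProjection_of_le hle,
    by
      ext1 x
      exact Submodule.starProjection_eq_self_iff.mpr
        (hle (Submodule.starProjection_apply_mem _ x))⟩

theorem star_P (r N : ℕ) : star (P r N) = P r N :=
  (isSelfAdjoint_starProjection (HilbN r N)).star_eq

/-- The algebra of all operators in `H_N` is `{A | P_N A P_N = A}`: an operator in `H_N` is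
extended by zero to the orthogonal complement, in accordance with the embeddings
of the operators in `H_N` into the operators in `H_{N+1}`. -/
def IsInN {r : ℕ} (N : ℕ) (A : Op r) : Prop := P r N * A * P r N = A

theorem IsInN.mono {r M N : ℕ} (h : M ≤ N) {A : Op r} (hA : IsInN M A) : IsInN N A := by
  obtain ⟨h1, h2⟩ := P_mul_P (r := r) h
  unfold IsInN at *
  rw [← hA]
  calc P r N * (P r M * A * P r M) * P r N = (P r N * P r M) * A * (P r M * P r N) := by
        simp only [mul_assoc]
    _ = P r M * A * P r M := by rw [h1, h2]

/-- The local algebra: the union of the algebras of all operators in `H_N`. -/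
def localAlgebra (r : ℕ) : NonUnitalStarSubalgebra ℂ (Op r) where
  carrier := {A | ∃ N, IsInN N A}
  zero_mem' := ⟨0, by simp [IsInN]⟩
  add_mem' := by
    rintro A B ⟨M, hA⟩ ⟨N, hB⟩
    refine ⟨max M N, ?_⟩
    have h1 := hA.mono (le_max_left M N)
    have h2 := hB.mono (le_max_right M N)
    unfold IsInN at *
    rw [mul_add, add_mul, h1, h2]
  mul_mem' := by
    rintro A B ⟨M, hA⟩ ⟨N, hB⟩
    refine ⟨max M N, ?_⟩
    have h1 := hA.mono (le_max_left M N)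
    have h2 := hB.mono (le_max_right M N)
    have hP := (P_mul_P (r := r) (le_refl (max M N))).1
    unfold IsInN at *
    generalize P r (max M N) = Q at *
    have h3 : Q * A = A := by rw [← h1]; simp only [← mul_assoc, hP]
    have h4 : B * Q = B := by rw [← h2]; simp only [mul_assoc, hP]
    rw [← mul_assoc, h3, mul_assoc, h4]
  smul_mem' := by
    rintro c A ⟨N, hA⟩
    refine ⟨N, ?_⟩
    unfold IsInN at *
    rw [mul_smul_comm, smul_mul_assoc, hA]
  star_mem' := by
    rintro A ⟨N, hA⟩
    refine ⟨N, ?_⟩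
    unfold IsInN at *
    conv_rhs => rw [← hA]
    rw [star_mul, star_mul, star_P, mul_assoc]

/-- The quasilocal algebra: the norm closure of the local algebra. -/
def quasilocalAlgebra (r : ℕ) : NonUnitalStarSubalgebra ℂ (Op r) :=
  (localAlgebra r).topologicalClosure

theorem local_le_quasilocal (r : ℕ) : localAlgebra r ≤ quasilocalAlgebra r :=
  (localAlgebra r).le_topologicalClosure

/-- A state on the quasilocal algebra: a positive linear functional of norm one. -/
def IsState {r : ℕ} (ω : quasilocalAlgebra r →ₗ[ℂ] ℂ) : Prop :=
  (∀ a : quasilocalAlgebra r, 0 ≤ ω (star a * a)) ∧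
    IsLUB {x : ℝ | ∃ a : quasilocalAlgebra r, ‖(a : Op r)‖ ≤ 1 ∧ x = ‖ω a‖} 1

/-- A symmetric grammar over an alphabet with `r` symbols: a finite set of substitutions `δ → γ`
with nonempty `δ`, `γ`, closed under inversion, with complex coefficients `λ` such that
the coefficients of mutually inverse substitutions are conjugate (so that `H = H*`). -/
structure SymmetricGrammar (r : ℕ) where
  sub : Finset (Word r × Word r)
  coeff : Word r × Word r → ℂ
  nonempty : ∀ p ∈ sub, p.1 ≠ [] ∧ p.2 ≠ []
  inverse_mem : ∀ p ∈ sub, p.swap ∈ sub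
  coeff_inverse : ∀ p ∈ sub, coeff p.swap = star (coeff p)

variable {r : ℕ}

/-- The cut-off Hamiltonian `H_N = ∑_i ∑_{j = 1}^N λ_i P_N a_i(j) P_N`. -/
def SymmetricGrammar.hamiltonian (G : SymmetricGrammar r) (N : ℕ) : Op r :=
  ∑ p ∈ G.sub, ∑ j ∈ Finset.Icc 1 N,
    G.coeff p • (P r N * quantumSubst p.1 p.2 j * P r N)

/-- The trace `Tr_N` over `H_N`, computed in the orthonormal basis `e_α`, `|α| ≤ N`. -/
def traceN (N : ℕ) (A : Op r) : ℂ := ∑ α ∈ words r N, inner ℂ (e α) (A (e α))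

/-- The operator `exp(-β H_N)`. It leaves `H_N` invariant; only its restriction
to `H_N` enters `Tr_N`. -/
def SymmetricGrammar.gibbsOp (G : SymmetricGrammar r) (β : ℝ) (N : ℕ) : Op r :=
  NormedSpace.exp (-(β : ℂ) • G.hamiltonian N)

/-- The partition function `Z_N = Tr_N exp(-β H_N)`. -/
def SymmetricGrammar.partitionFn (G : SymmetricGrammar r) (β : ℝ) (N : ℕ) : ℂ :=
  traceN N (G.gibbsOp β N)

/-- The finite volume Gibbs functional `⟨A⟩_{β,N} = Z_N⁻¹ Tr_N [A exp(-β H_N)]`. -/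
def SymmetricGrammar.gibbs (G : SymmetricGrammar r) (β : ℝ) (N : ℕ) (A : Op r) : ℂ :=
  (G.partitionFn β N)⁻¹ * traceN N (A * G.gibbsOp β N)

end QuantumGrammar

end

/-!
Write `C = ∑ |λ_i|`. Then `‖H_N‖ ≤ C N`, whereas the space `HilbN r N` has dimension at least
`r ^ N`. For `2 |β| C < log r` this settles everything except the existence of
`lim (log Z_N) / N`: `Z_N` is a sum of exponentials of real numbers and at least
`r ^ N exp (-|β| C N)`, which bounds the limit from below by `log r - |β| C`, more than `1` if
`r ≥ 3` and `β` is small, as `log 3 > 1`; and `Tr_N (A exp (-β H_N))` is, for a fixed local `A`, a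
trace over finitely many basis vectors and of order `exp (|β| C N)` only, so `⟨A⟩_{β,N}` tends to
zero (`SymmetricGrammar.tendsto_gibbs_zero`). A state that is the limit would vanish on the dense
local algebra, hence be zero (`IsState.exists_local_ne_zero`).

The limit exists because `log Z_N` is nearly subadditive. As substitutions change lengths, a word
cannot be cut at a fixed place in a way that is compatible with the dynamics. Instead `e_α` is
mapped to the superposition, with equal amplitudes `1 / √L`, of all `e_{α₁} ⊗ e_{α₂}` with
`α = α₁ α₂` and `q ≤ |α₁| < q + L`; a cut beyond the end of `α` is recorded by the number of
missing letters. This is an isometry `V` (`sum_norm_cut_sq`), and `V* (H ⊗ 1 + 1 ⊗ H) V` differs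
from `H` only by the substitutions that straddle the cut (a fraction of order `1 / L` for each of
the `L` places of the window) and by those before the cut that push it out of the window (again a
fraction of order `1 / L`, for each of `q + L` places). Hence the error has norm of order
`(q + L) / L` (`SymmetricGrammar.norm_form_sub_cut_le`). By Jensen's inequality
(`sum_exp_le_of_le_sum_mul`) this gives `Z_{q+R} ≤ exp (K (q + L) / L) (q + L) Z_{q+L} Z_R`
(`SymmetricGrammar.partition_add_le`), the factor `q + L` being the number of values of the
record. With `L` of the order of the square root of `q + L` all errors are sublinear, and the
argument for subadditive sequences applies (`exists_tendsto_div_of_subadditive_overlap`).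
-/

noncomputable section

namespace QuantumGrammar

/-! ### Replacing a subword, and the matrix elements of the Hamiltonian -/

/-- The result of replacing the `δ` that starts after the first `j` letters of `α` by `γ`. -/
def replace {r : ℕ} (δ γ : Word r) (j : ℕ) (α : Word r) : Word r :=
  α.take j ++ γ ++ α.drop (j + δ.length)

section Replace

variable {r : ℕ} {δ γ : Word r} {j k : ℕ} {α α' : Word r}

theorem lt_length_of_prefix_drop (hδ : δ ≠ []) (h : δ <+: α.drop j) : j < α.length := by
  have h1 := h.length_le
  have h2 := List.length_pos_iff.mpr hδ
  rw [List.length_drop] at h1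
  omega

theorem add_length_le_of_prefix_drop (hδ : δ ≠ []) (h : δ <+: α.drop j) :
    j + δ.length ≤ α.length := by
  have h1 := h.length_le
  have h2 := List.length_pos_iff.mpr hδ
  rw [List.length_drop] at h1
  omega

theorem eq_append_of_prefix_drop (h : δ <+: α.drop j) :
    α = α.take j ++ δ ++ α.drop (j + δ.length) := by
  obtain ⟨ρ, hρ⟩ := h
  have h3 : α.drop (j + δ.length) = ρ := by
    rw [← List.drop_drop, ← hρ, List.drop_left]
  rw [h3, List.append_assoc, hρ, List.take_append_drop]

theorem isSubst_succ_iff (hδ : δ ≠ []) :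
    IsSubst δ γ (j + 1) α α' ↔ δ <+: α.drop j ∧ α' = replace δ γ j α := by
  constructor
  · rintro ⟨τ, ρ, h1, rfl, rfl⟩
    obtain rfl : τ.length = j := by omega
    refine ⟨by simp [List.append_assoc], ?_⟩
    simp [replace, List.append_assoc, ← List.drop_drop]
  · rintro ⟨h, rfl⟩
    have hj := lt_length_of_prefix_drop hδ h
    exact ⟨α.take j, α.drop (j + δ.length), by simp; omega, eq_append_of_prefix_drop h, rfl⟩

theorem IsSubst.symm (h : IsSubst δ γ j α α') : IsSubst γ δ j α' α := by
  obtain ⟨τ, ρ, h1, h2, h3⟩ := h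
  exact ⟨τ, ρ, h1, h3, h2⟩

theorem length_replace (hδ : δ ≠ []) (h : δ <+: α.drop j) :
    (replace δ γ j α).length + δ.length = α.length + γ.length := by
  have h1 := add_length_le_of_prefix_drop hδ h
  simp only [replace, List.length_append, List.length_take, List.length_drop]
  omega

theorem replace_injOn (hδ : δ ≠ []) (γ : Word r) (j : ℕ) :
    Set.InjOn (replace δ γ j) {α | δ <+: α.drop j} := by
  intro α hα α' hα' h
  exact ((isSubst_succ_iff hδ).mpr ⟨hα, rfl⟩).symm.right_unique
    ((isSubst_succ_iff hδ).mpr ⟨hα', h⟩).symm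

theorem prefix_drop_take_iff (hδ : δ ≠ []) :
    δ <+: (α.take k).drop j ↔ δ <+: α.drop j ∧ j + δ.length ≤ k := by
  have h2 := List.length_pos_iff.mpr hδ
  rw [List.drop_take, List.prefix_take_iff]
  exact and_congr_right fun _ => by omega

theorem replace_take_append_drop (h : j + δ.length ≤ k) :
    replace δ γ j (α.take k) ++ α.drop k = replace δ γ j α := by
  simp only [replace, List.append_assoc, List.take_take, List.drop_take]
  rw [min_eq_left (by omega)]
  congr 2
  obtain ⟨l, rfl⟩ := Nat.exists_eq_add_of_le h
  rw [← List.drop_drop (i := l), Nat.add_sub_cancel_left, List.take_append_drop]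

theorem take_append_replace_drop :
    α.take k ++ replace δ γ j (α.drop k) = replace δ γ (k + j) α := by
  simp only [replace, List.drop_drop, List.take_add, List.append_assoc, Nat.add_assoc]

end Replace

variable {r : ℕ}

theorem mem_words {N : ℕ} {α : Word r} : α ∈ words r N ↔ α.length ≤ N := by
  simp [words]

theorem inner_e_left (α : Word r) (x : Hilb r) : inner ℂ (e α) x = x α := by
  simp [e, lp.inner_single_left]

theorem e_apply (α β : Word r) : e α β = if β = α then 1 else 0 := by
  classical
  simp only [e, lp.single_apply, Pi.single_apply]

theorem norm_e (α : Word r) : ‖e α‖ = 1 := by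
  simp [e, lp.norm_single]

open Classical in
theorem quantumSubst_e_apply (δ γ : Word r) (j : ℕ) (α β : Word r) :
    quantumSubst δ γ j (e α) β = if IsSubst δ γ j α β then 1 else 0 := by
  change substFun δ γ j (e α) β = _
  unfold substFun
  split_ifs with h h' h'
  · have := h.choose_spec.symm.right_unique h'.symm
    rw [this, e_apply, if_pos rfl]
  · rw [e_apply, if_neg]
    intro h2
    exact h' (h2 ▸ h.choose_spec)
  · exact absurd ⟨_, h'⟩ h
  · rfl

open Classical in
theorem quantumSubst_e {δ : Word r} (hδ : δ ≠ []) (γ : Word r) (j : ℕ) (α : Word r) :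
    quantumSubst δ γ (j + 1) (e α)
      = if δ <+: α.drop j then e (replace δ γ j α) else 0 := by
  ext β
  rw [quantumSubst_e_apply]
  by_cases h : δ <+: α.drop j <;> simp [isSubst_succ_iff hδ, h, e_apply]

theorem inner_quantumSubst (δ γ : Word r) (j : ℕ) (α β : Word r) :
    inner ℂ (e α) (quantumSubst δ γ j (e β))
      = starRingEnd ℂ (inner ℂ (e β) (quantumSubst γ δ j (e α))) := by
  have h : IsSubst δ γ j β α ↔ IsSubst γ δ j α β := ⟨IsSubst.symm, IsSubst.symm⟩
  rw [inner_e_left, inner_e_left, quantumSubst_e_apply, quantumSubst_e_apply]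
  split_ifs <;> simp_all

theorem e_mem_HilbN {N : ℕ} {α : Word r} (h : α ∈ words r N) : e α ∈ HilbN r N :=
  Submodule.subset_span ⟨α, h, rfl⟩

/-- Vectors of `H_N` are the combinations of the `e_α`, `|α| ≤ N`, with their own coordinates. -/
theorem sum_smul_e {N : ℕ} {x : Hilb r} (hx : x ∈ HilbN r N) :
    ∑ α ∈ words r N, x α • e α = x := by
  classical
  induction hx using Submodule.span_induction with
  | mem x hx =>
    obtain ⟨β, hβ, rfl⟩ := hx
    rw [Finset.sum_eq_single_of_mem β hβ]
    · simp [e_apply]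
    · intro α _ hα
      simp [e_apply, hα]
  | zero => simp
  | add x y _ _ hx hy =>
    simp only [lp.coeFn_add, Pi.add_apply, add_smul, Finset.sum_add_distrib, hx, hy]
  | smul c x _ hx =>
    simp only [lp.coeFn_smul, Pi.smul_apply, smul_assoc, ← Finset.smul_sum, hx]

theorem apply_eq_zero_of_mem_HilbN {N : ℕ} {x : Hilb r} (hx : x ∈ HilbN r N) {α : Word r}
    (hα : α ∉ words r N) : x α = 0 := by
  rw [← inner_e_left, ← sum_smul_e hx, inner_sum]
  refine Finset.sum_eq_zero fun β hβ => ?_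
  rw [inner_smul_right, inner_e_left, e_apply, if_neg, mul_zero]
  rintro rfl
  exact hα hβ

theorem inner_eq_sum {N : ℕ} {x : Hilb r} (hx : x ∈ HilbN r N) (y : Hilb r) :
    inner ℂ x y = ∑ α ∈ words r N, starRingEnd ℂ (x α) * y α := by
  conv_lhs => rw [← sum_smul_e hx]
  simp only [sum_inner, inner_smul_left, inner_e_left]

theorem P_apply_of_mem {N : ℕ} {x : Hilb r} (hx : x ∈ HilbN r N) : P r N x = x :=
  Submodule.starProjection_eq_self_iff.mpr hx

theorem P_apply_mem (N : ℕ) (x : Hilb r) : P r N x ∈ HilbN r N :=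
  Submodule.starProjection_apply_mem _ x

theorem inner_P_left (N : ℕ) (x y : Hilb r) : inner ℂ (P r N x) y = inner ℂ x (P r N y) :=
  Submodule.inner_starProjection_left_eq_right _ x y

theorem norm_P_le (N : ℕ) : ‖P r N‖ ≤ 1 := Submodule.starProjection_norm_le _

theorem norm_quantumSubst_le (δ γ : Word r) (j : ℕ) : ‖quantumSubst δ γ j‖ ≤ 1 :=
  LinearMap.mkContinuous_norm_le _ zero_le_one _

theorem inner_e_PAP {N : ℕ} {α : Word r} (h : α ∈ words r N) (A : Op r) {x : Hilb r}
    (hx : x ∈ HilbN r N) : inner ℂ (e α) ((P r N * A * P r N) x) = inner ℂ (e α) (A x) := by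
  change inner ℂ (e α) (P r N (A (P r N x))) = _
  rw [P_apply_of_mem hx, ← inner_P_left, P_apply_of_mem (e_mem_HilbN h)]

namespace SymmetricGrammar

variable (G : SymmetricGrammar r)

/-- The sum `∑_i |λ_i|`: the operator `H_N` has norm at most `N` times this constant. -/
def coupling : ℝ := ∑ p ∈ G.sub, ‖G.coeff p‖

theorem coupling_nonneg : 0 ≤ G.coupling := Finset.sum_nonneg fun _ _ => norm_nonneg _

theorem norm_hamiltonian_le (N : ℕ) : ‖G.hamiltonian N‖ ≤ G.coupling * N := by
  unfold hamiltonian coupling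
  rw [Finset.sum_mul]
  refine (norm_sum_le _ _).trans (Finset.sum_le_sum fun p _ => ?_)
  refine (norm_sum_le _ _).trans ?_
  have h : ∀ j ∈ Finset.Icc 1 N,
      ‖G.coeff p • (P r N * quantumSubst p.1 p.2 j * P r N)‖ ≤ ‖G.coeff p‖ := by
    intro j _
    rw [norm_smul]
    refine mul_le_of_le_one_right (norm_nonneg _) ?_
    refine (norm_mul_le _ _).trans (mul_le_one₀ ?_ (norm_nonneg _) (norm_P_le N))
    exact (norm_mul_le _ _).trans
      (mul_le_one₀ (norm_P_le N) (norm_nonneg _) (norm_quantumSubst_le _ _ _))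
  refine (Finset.sum_le_sum h).trans ?_
  simp [mul_comm]

theorem hamiltonian_mem (N : ℕ) (x : Hilb r) : G.hamiltonian N x ∈ HilbN r N := by
  simp only [hamiltonian, _root_.sum_apply]
  refine Submodule.sum_mem _ fun p _ => Submodule.sum_mem _ fun j _ => ?_
  exact Submodule.smul_mem _ _ (P_apply_mem N _)

theorem inner_e_hamiltonian {N : ℕ} {α β : Word r} (hα : α ∈ words r N) (hβ : β ∈ words r N) :
    inner ℂ (e α) (G.hamiltonian N (e β))
      = starRingEnd ℂ (inner ℂ (e β) (G.hamiltonian N (e α))) := by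
  simp only [hamiltonian, _root_.sum_apply, _root_.smul_apply,
    inner_sum, inner_smul_right, inner_e_PAP hα _ (e_mem_HilbN hβ),
    inner_e_PAP hβ _ (e_mem_HilbN hα), map_sum, map_mul]
  refine Finset.sum_nbij' Prod.swap Prod.swap G.inverse_mem G.inverse_mem (by simp) (by simp) ?_
  intro p hp
  refine Finset.sum_congr rfl fun j _ => ?_
  rw [inner_quantumSubst, G.coeff_inverse p hp]
  simp

theorem inner_hamiltonian {N : ℕ} {x y : Hilb r} (hx : x ∈ HilbN r N) (hy : y ∈ HilbN r N) :
    inner ℂ (G.hamiltonian N x) y = inner ℂ x (G.hamiltonian N y) := by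
  rw [← sum_smul_e hx, ← sum_smul_e hy]
  simp only [map_sum, map_smul, sum_inner, inner_sum, inner_smul_left, inner_smul_right]
  refine Finset.sum_congr rfl fun α hα => ?_
  congr 1
  refine Finset.sum_congr rfl fun β hβ => ?_
  rw [G.inner_e_hamiltonian hβ hα, inner_conj_symm]

/-- The contribution `∑_α conj (f (τ γ ρ)) f (τ δ ρ)` of the substitution `p = (δ, γ)` at the
letters following the first `j` ones to the quadratic form of the Hamiltonian; the sum extends
over the words `α = τ δ ρ` with `|α| ≤ N` and `|τ| = j`. -/
def substForm (p : Word r × Word r) (j N : ℕ) (f : Word r → ℂ) : ℂ :=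
  open Classical in ∑ α ∈ words r N,
    if p.1 <+: α.drop j then starRingEnd ℂ (f (replace p.1 p.2 j α)) * f α else 0

/-- The quadratic form of the Hamiltonian `H_N`. -/
def form (N : ℕ) (f : Word r → ℂ) : ℂ :=
  ∑ p ∈ G.sub, G.coeff p * ∑ j ∈ Finset.range N, substForm p j N f

theorem inner_hamiltonian_self {N : ℕ} {x : Hilb r} (hx : x ∈ HilbN r N) :
    inner ℂ x (G.hamiltonian N x) = G.form N x := by
  classical
  simp only [hamiltonian, _root_.sum_apply, _root_.smul_apply,
    inner_sum, inner_smul_right, form, Finset.mul_sum]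
  refine Finset.sum_congr rfl fun p hp => ?_
  have hIcc : Finset.Icc 1 N = Finset.Ico (0 + 1) (N + 1) := by ext; simp
  rw [hIcc, ← Finset.sum_Ico_add', Finset.range_eq_Ico]
  refine Finset.sum_congr rfl fun j _ => ?_
  congr 1
  have h1 : inner ℂ x ((P r N * quantumSubst p.1 p.2 (j + 1) * P r N) x)
      = inner ℂ x (quantumSubst p.1 p.2 (j + 1) x) := by
    change inner ℂ x (P r N (quantumSubst p.1 p.2 (j + 1) (P r N x))) = _
    rw [← inner_P_left, P_apply_of_mem hx]
  rw [h1]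
  conv_lhs => rw [← sum_smul_e hx]
  rw [map_sum, sum_smul_e hx, inner_sum, substForm]
  refine Finset.sum_congr rfl fun α _ => ?_
  rw [map_smul, inner_smul_right, quantumSubst_e (G.nonempty p hp).1]
  split_ifs
  · rw [← inner_conj_symm, inner_e_left, mul_comm]
  · simp

end SymmetricGrammar

/-! ### Spectral decomposition of the cut-off Hamiltonian -/

/-- The exponential of an operator acts on an eigenvector by the exponential of the eigenvalue. -/
theorem exp_apply_of_eigenvector {A : Op r} {x : Hilb r} {c : ℂ} (h : A x = c • x) :
    NormedSpace.exp A x = Complex.exp c • x := by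
  have hpow : ∀ n : ℕ, (A ^ n) x = c ^ n • x := by
    intro n
    induction n with
    | zero => simp
    | succ n ih =>
      rw [pow_succ, mul_apply_eq_comp, h, map_smul, ih, smul_smul, pow_succ, mul_comm]
  have h1 := (NormedSpace.exp_series_hasSum_exp' (𝕂 := ℂ) A).mapL
    (ContinuousLinearMap.apply ℂ (Hilb r) x)
  have h2 := (NormedSpace.exp_series_hasSum_exp' (𝕂 := ℂ) c).smul_const x
  rw [← Complex.exp_eq_exp_ℂ] at h2
  refine h1.unique ?_
  convert h2 using 2 with n
  simp [hpow, smul_smul]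

theorem norm_exp_le (A : Op r) : ‖NormedSpace.exp A‖ ≤ Real.exp ‖A‖ := by
  have h2 := NormedSpace.exp_series_hasSum_exp' (𝕂 := ℝ) ‖A‖
  rw [← Real.exp_eq_exp_ℝ] at h2
  refine (NormedSpace.exp_series_hasSum_exp' (𝕂 := ℂ) A).norm_le_of_bounded h2 fun n => ?_
  rw [norm_smul, norm_inv, Complex.norm_natCast, smul_eq_mul]
  gcongr
  rcases n with _ | n
  · rw [pow_zero, pow_zero]
    exact ContinuousLinearMap.norm_id_le
  · exact norm_pow_le' A (Nat.succ_pos n)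

theorem sum_norm_sq_of_mem_HilbN {N : ℕ} {x : Hilb r} (hx : x ∈ HilbN r N) :
    ∑ α ∈ words r N, ‖x α‖ ^ 2 = ‖x‖ ^ 2 := by
  have h := inner_eq_sum hx x
  rw [inner_self_eq_norm_sq_to_K] at h
  simp only [Complex.conj_mul'] at h
  apply Complex.ofReal_injective
  push_cast
  exact h.symm

/-- The vector of `H_N` with coordinates `f α`, `|α| ≤ N`. -/
def ofFun (N : ℕ) (f : Word r → ℂ) : HilbN r N :=
  ⟨∑ α ∈ words r N, f α • e α,
    Submodule.sum_mem _ fun _ hα => Submodule.smul_mem _ _ (e_mem_HilbN hα)⟩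

theorem ofFun_apply {N : ℕ} (f : Word r → ℂ) {α : Word r} (hα : α ∈ words r N) :
    (ofFun N f : Hilb r) α = f α := by
  classical
  rw [← inner_e_left, ofFun, inner_sum, Finset.sum_eq_single_of_mem α hα]
  · rw [inner_smul_right, inner_e_left, e_apply, if_pos rfl, mul_one]
  · intro β _ hβ
    simp [inner_smul_right, inner_e_left, e_apply, hβ.symm]

namespace SymmetricGrammar

variable (G : SymmetricGrammar r)

/-- The Hamiltonian `H_N` as an endomorphism of the finite dimensional space `H_N`. -/
def restricted (N : ℕ) : HilbN r N →ₗ[ℂ] HilbN r N :=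
  (G.hamiltonian N).toLinearMap.restrict fun x _ => G.hamiltonian_mem N x

theorem restricted_isSymmetric (N : ℕ) : (G.restricted N).IsSymmetric := fun x y =>
  G.inner_hamiltonian x.2 y.2

/-- An orthonormal basis of `H_N` that consists of eigenvectors of the Hamiltonian. -/
def eigenbasis (N : ℕ) : OrthonormalBasis (Fin (Module.finrank ℂ (HilbN r N))) ℂ (HilbN r N) :=
  (G.restricted_isSymmetric N).eigenvectorBasis rfl

/-- The eigenvalues of the Hamiltonian on `H_N`, with multiplicity. -/
def level (N : ℕ) (i : Fin (Module.finrank ℂ (HilbN r N))) : ℝ :=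
  (G.restricted_isSymmetric N).eigenvalues rfl i

theorem hamiltonian_eigenbasis (N : ℕ) (i) :
    G.hamiltonian N (G.eigenbasis N i : Hilb r) = (G.level N i : ℂ) • (G.eigenbasis N i : Hilb r) :=
  congrArg Subtype.val ((G.restricted_isSymmetric N).apply_eigenvectorBasis rfl i)

theorem sum_inner_eigenbasis_smul {N : ℕ} {x : Hilb r} (hx : x ∈ HilbN r N) :
    ∑ i, inner ℂ (G.eigenbasis N i : Hilb r) x • (G.eigenbasis N i : Hilb r) = x := by
  have h := congrArg Subtype.val ((G.eigenbasis N).sum_repr' ⟨x, hx⟩)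
  simpa using h

theorem gibbsOp_eigenbasis (β : ℝ) (N : ℕ) (i) :
    G.gibbsOp β N (G.eigenbasis N i : Hilb r)
      = (Real.exp (-β * G.level N i) : ℂ) • (G.eigenbasis N i : Hilb r) := by
  rw [gibbsOp, exp_apply_of_eigenvector (c := -(β : ℂ) * (G.level N i : ℂ))]
  · push_cast
    rfl
  · rw [_root_.smul_apply, hamiltonian_eigenbasis, smul_smul]

/-- The partition function as a sum over the spectrum of the Hamiltonian. -/
theorem partitionFn_eq (β : ℝ) (N : ℕ) :
    G.partitionFn β N = ((∑ i, Real.exp (-β * G.level N i) : ℝ) : ℂ) := by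
  have h1 : ∀ α ∈ words r N, inner ℂ (e α) (G.gibbsOp β N (e α))
      = ∑ i, (Real.exp (-β * G.level N i) : ℂ) *
        (starRingEnd ℂ ((G.eigenbasis N i : Hilb r) α) * (G.eigenbasis N i : Hilb r) α) := by
    intro α hα
    conv_lhs => rw [← G.sum_inner_eigenbasis_smul (e_mem_HilbN hα)]
    rw [map_sum, G.sum_inner_eigenbasis_smul (e_mem_HilbN hα), inner_sum]
    refine Finset.sum_congr rfl fun i _ => ?_
    rw [map_smul, gibbsOp_eigenbasis, inner_smul_right, inner_smul_right, inner_e_left,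
      ← inner_conj_symm, inner_e_left]
    ring
  rw [partitionFn, traceN, Finset.sum_congr rfl h1, Finset.sum_comm]
  push_cast
  refine Finset.sum_congr rfl fun i _ => ?_
  rw [← Finset.mul_sum, ← inner_eq_sum (G.eigenbasis N i).2, inner_self_eq_norm_sq_to_K]
  have : ‖(G.eigenbasis N i : Hilb r)‖ = 1 := (G.eigenbasis N).orthonormal.1 i
  simp [this]

/-- The amplitude of the restriction of `f` to the words of length at most `N` in the `i`-th
eigenvector of the Hamiltonian. -/
def amplitude (N : ℕ) (i : Fin (Module.finrank ℂ (HilbN r N))) (f : Word r → ℂ) : ℂ :=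
  ∑ α ∈ words r N, starRingEnd ℂ ((G.eigenbasis N i : Hilb r) α) * f α

theorem amplitude_eq_inner (N : ℕ) (i) (f : Word r → ℂ) :
    G.amplitude N i f = inner ℂ (G.eigenbasis N i) (ofFun N f) := by
  rw [Submodule.coe_inner, inner_eq_sum (G.eigenbasis N i).2]
  refine Finset.sum_congr rfl fun α hα => ?_
  rw [ofFun_apply f hα]

/-- Parseval's identity for the eigenbasis. -/
theorem sum_norm_amplitude_sq (N : ℕ) (f : Word r → ℂ) :
    ∑ i, ‖G.amplitude N i f‖ ^ 2 = ∑ α ∈ words r N, ‖f α‖ ^ 2 := by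
  simp only [amplitude_eq_inner]
  rw [OrthonormalBasis.sum_sq_norm_inner_right]
  change ‖(ofFun N f : Hilb r)‖ ^ 2 = _
  rw [← sum_norm_sq_of_mem_HilbN (ofFun N f).2]
  exact Finset.sum_congr rfl fun α hα => by rw [ofFun_apply f hα]

/-- The quadratic form of the Hamiltonian in terms of its spectrum. -/
theorem sum_level_mul_norm_amplitude_sq (N : ℕ) {f : Word r → ℂ} (hf : ∀ α ∉ words r N, f α = 0) :
    ((∑ i, G.level N i * ‖G.amplitude N i f‖ ^ 2 : ℝ) : ℂ) = G.form N f := by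
  have hfun : ⇑(ofFun N f : Hilb r) = f := by
    funext α
    by_cases hα : α ∈ words r N
    · exact ofFun_apply f hα
    · rw [apply_eq_zero_of_mem_HilbN (ofFun N f).2 hα, hf α hα]
  have h := G.inner_hamiltonian_self (ofFun N f).2
  rw [hfun] at h
  rw [← h]
  conv_rhs => rw [← G.sum_inner_eigenbasis_smul (ofFun N f).2]
  rw [map_sum, G.sum_inner_eigenbasis_smul (ofFun N f).2, inner_sum]
  push_cast
  refine Finset.sum_congr rfl fun i _ => ?_
  rw [map_smul, hamiltonian_eigenbasis, inner_smul_right, inner_smul_right, amplitude_eq_inner,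
    ← inner_conj_symm (ofFun N f : Hilb r), ← Submodule.coe_inner, ← Complex.mul_conj']
  ring

theorem sum_norm_eigenbasis_sq (N : ℕ) (i) :
    ∑ α ∈ words r N, ‖(G.eigenbasis N i : Hilb r) α‖ ^ 2 = 1 := by
  have h1 : ‖(G.eigenbasis N i : Hilb r)‖ = 1 := (G.eigenbasis N).orthonormal.1 i
  rw [sum_norm_sq_of_mem_HilbN (G.eigenbasis N i).2, h1, one_pow]

theorem abs_level_le (N : ℕ) (i) : |G.level N i| ≤ G.coupling * N := by
  have h1 : ‖(G.eigenbasis N i : Hilb r)‖ = 1 := (G.eigenbasis N).orthonormal.1 i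
  have h2 := congrArg norm (G.hamiltonian_eigenbasis N i)
  rw [norm_smul, h1, mul_one, Complex.norm_real, Real.norm_eq_abs] at h2
  rw [← h2]
  refine ((G.hamiltonian N).le_opNorm _).trans ?_
  rw [h1, mul_one]
  exact G.norm_hamiltonian_le N

end SymmetricGrammar

/-! ### Cutting words -/

/-- The pieces of a word under cutting: `α₁` and `α₂` are the parts before and after the cut and
`d` is the number of letters by which the cut lies beyond the end of the word. The place of the
cut is `|α₁| + d`, and it is required to lie in the window `[q, q + L)`. -/
def IsCut (q L : ℕ) (α₁ α₂ : Word r) (d : ℕ) : Prop :=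
  (d = 0 ∨ α₂ = []) ∧ q ≤ α₁.length + d ∧ α₁.length + d < q + L

/-- Summation over the pieces is summation over the words and the places of the cut. -/
theorem sum_isCut {M : Type*} [AddCommMonoid M] (q L R : ℕ) (g : Word r → Word r → ℕ → M)
    (hg : ∀ α₁ α₂ d, α₁ ++ α₂ ∉ words r (q + R) → g α₁ α₂ d = 0) :
    (open Classical in ∑ α₁ ∈ words r (q + L), ∑ α₂ ∈ words r R, ∑ d ∈ Finset.range (q + L),
      if IsCut q L α₁ α₂ d then g α₁ α₂ d else 0)
      = ∑ α ∈ words r (q + R), ∑ k ∈ Finset.Ico q (q + L),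
          g (α.take k) (α.drop k) (k - α.length) := by
  classical
  let S := (words r (q + L) ×ˢ words r R ×ˢ Finset.range (q + L)).filter
    fun x => IsCut q L x.1 x.2.1 x.2.2 ∧ x.1 ++ x.2.1 ∈ words r (q + R)
  -- The bijection is `(α₁, α₂, d) ↦ (α₁ ++ α₂, |α₁| + d)`.
  have h1 : (∑ α₁ ∈ words r (q + L), ∑ α₂ ∈ words r R, ∑ d ∈ Finset.range (q + L),
      if IsCut q L α₁ α₂ d then g α₁ α₂ d else 0) = ∑ x ∈ S, g x.1 x.2.1 x.2.2 := by
    rw [Finset.sum_filter, Finset.sum_product]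
    refine Finset.sum_congr rfl fun α₁ _ => ?_
    rw [Finset.sum_product]
    refine Finset.sum_congr rfl fun α₂ _ => Finset.sum_congr rfl fun d _ => ?_
    by_cases h : α₁ ++ α₂ ∈ words r (q + R)
    · simp [h]
    · simp [h, hg _ _ d h]
  rw [h1, ← Finset.sum_product']
  refine Finset.sum_nbij' (fun x => (x.1 ++ x.2.1, x.1.length + x.2.2))
    (fun y => (y.1.take y.2, y.1.drop y.2, y.2 - y.1.length)) ?_ ?_ ?_ ?_ ?_
  · rintro ⟨α₁, α₂, d⟩ hx
    obtain ⟨⟨-, h3⟩, h4⟩ := (Finset.mem_filter.mp hx).2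
    exact Finset.mem_product.mpr ⟨h4, Finset.mem_Ico.mpr h3⟩
  · rintro ⟨α, k⟩ hy
    simp only [Finset.mem_product, Finset.mem_Ico, mem_words] at hy
    simp only [S, Finset.mem_filter, IsCut, Finset.mem_product, mem_words, Finset.mem_range,
      List.length_take, List.length_drop, List.take_append_drop, List.drop_eq_nil_iff]
    omega
  · rintro ⟨α₁, α₂, d⟩ hx
    obtain ⟨⟨h2, -⟩, -⟩ := (Finset.mem_filter.mp hx).2
    rcases h2 with rfl | rfl
    · simp
    · simp
  · rintro ⟨α, k⟩ hy
    simp only [List.take_append_drop, List.length_take]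
    congr 1
    omega
  · rintro ⟨α₁, α₂, d⟩ hx
    obtain ⟨⟨h2, -⟩, -⟩ := (Finset.mem_filter.mp hx).2
    rcases h2 with rfl | rfl
    · simp
    · simp [List.take_of_length_le, List.drop_eq_nil_of_le]

/-- The image of `u` under the isometry that sends `e_α` to the superposition, with equal weights,
of all cuts of `α` at a place of the window `[q, q + L)`. -/
def cut (q L : ℕ) (u : Word r → ℂ) (α₁ α₂ : Word r) (d : ℕ) : ℂ :=
  open Classical in if IsCut q L α₁ α₂ d then (√(L : ℝ) : ℂ)⁻¹ * u (α₁ ++ α₂) else 0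

theorem inv_sqrt_mul_self (L : ℕ) : (√(L : ℝ) : ℂ)⁻¹ * (√(L : ℝ) : ℂ)⁻¹ = (L : ℂ)⁻¹ := by
  rw [← mul_inv, ← Complex.ofReal_mul, Real.mul_self_sqrt (Nat.cast_nonneg L),
    Complex.ofReal_natCast]

theorem sum_norm_cut_sq {q L R : ℕ} (hL : 0 < L) {u : Word r → ℂ}
    (hu : ∀ α ∉ words r (q + R), u α = 0) :
    ∑ α₁ ∈ words r (q + L), ∑ α₂ ∈ words r R, ∑ d ∈ Finset.range (q + L),
      ‖cut q L u α₁ α₂ d‖ ^ 2 = ∑ α ∈ words r (q + R), ‖u α‖ ^ 2 := by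
  classical
  have h := sum_isCut q L R (fun α₁ α₂ _ => (L : ℝ)⁻¹ * ‖u (α₁ ++ α₂)‖ ^ 2)
    (fun α₁ α₂ _ h => by simp [hu _ h])
  have hL' : (L : ℝ) ≠ 0 := by positivity
  simp only [List.take_append_drop, Finset.sum_const, Nat.card_Ico, Nat.add_sub_cancel_left,
    nsmul_eq_mul, mul_inv_cancel_left₀ hL'] at h
  rw [← h]
  refine Finset.sum_congr rfl fun α₁ _ => Finset.sum_congr rfl fun α₂ _ =>
    Finset.sum_congr rfl fun d _ => ?_
  unfold cut
  split_ifs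
  · rw [norm_mul, mul_pow, norm_inv, Complex.norm_real, Real.norm_of_nonneg (Real.sqrt_nonneg _),
      inv_pow, Real.sq_sqrt (Nat.cast_nonneg L)]
  · simp

theorem cut_eq_zero_of_left {q L : ℕ} (u : Word r → ℂ) {α₁ : Word r} (h : α₁ ∉ words r (q + L))
    (α₂ : Word r) (d : ℕ) : cut q L u α₁ α₂ d = 0 := by
  rw [cut, if_neg]
  rintro ⟨-, -, h3⟩
  rw [mem_words] at h
  omega

theorem cut_eq_zero_of_right {q L R : ℕ} {u : Word r → ℂ}
    (hu : ∀ α ∉ words r (q + R), u α = 0) (α₁ : Word r) {α₂ : Word r} (h : α₂ ∉ words r R)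
    (d : ℕ) : cut q L u α₁ α₂ d = 0 := by
  unfold cut
  split_ifs with hc
  · obtain ⟨h1, h2, -⟩ := hc
    rw [mem_words] at h
    rw [hu, mul_zero]
    rw [mem_words, List.length_append]
    rcases h1 with rfl | rfl
    · omega
    · simp at h
  · rfl

open SymmetricGrammar

theorem substForm_eq_zero {p : Word r × Word r} (hp : p.1 ≠ []) {j N : ℕ} (h : N ≤ j)
    (u : Word r → ℂ) : substForm p j N u = 0 := by
  refine Finset.sum_eq_zero fun α hα => ?_
  rw [if_neg]
  intro h2
  have := lt_length_of_prefix_drop hp h2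
  rw [mem_words] at hα
  omega

/-- Every single substitution contributes at most the squared norm to the quadratic form, since
replacing at a fixed place is injective. -/
theorem norm_substForm_le {p : Word r × Word r} (hp : p.1 ≠ []) (j : ℕ) {N : ℕ} {u : Word r → ℂ}
    (hu : ∀ α ∉ words r N, u α = 0) :
    ‖substForm p j N u‖ ≤ ∑ α ∈ words r N, ‖u α‖ ^ 2 := by
  classical
  -- AM-GM bounds each term by squared moduli.
  have h1 : ‖substForm p j N u‖ ≤ ∑ α ∈ words r N, if p.1 <+: α.drop j then
      (‖u (replace p.1 p.2 j α)‖ ^ 2 + ‖u α‖ ^ 2) / 2 else 0 := by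
    refine (norm_sum_le _ _).trans (Finset.sum_le_sum fun α _ => ?_)
    split_ifs
    · rw [norm_mul, RCLike.norm_conj]
      nlinarith [sq_nonneg (‖u (replace p.1 p.2 j α)‖ - ‖u α‖)]
    · simp
  have h2 : ∑ α ∈ (words r N).filter (fun α => p.1 <+: α.drop j), ‖u (replace p.1 p.2 j α)‖ ^ 2
      ≤ ∑ α ∈ words r N, ‖u α‖ ^ 2 := by
    have hinj : Set.InjOn (replace p.1 p.2 j)
        ((words r N).filter (fun α => p.1 <+: α.drop j) : Finset (Word r)) :=
      (replace_injOn hp p.2 j).mono fun α hα => (Finset.mem_filter.mp hα).2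
    rw [← Finset.sum_image (f := fun α => ‖u α‖ ^ 2) hinj]
    -- Replaced words may be too long, but `u` vanishes on those.
    rw [← Finset.sum_filter_of_ne (p := fun α => α ∈ words r N)]
    · exact Finset.sum_le_sum_of_subset_of_nonneg (fun α hα => (Finset.mem_filter.mp hα).2)
        fun _ _ _ => sq_nonneg _
    · intro α _ hne
      by_contra hc
      exact hne (by simp [hu α hc])
  have h3 : ∑ α ∈ (words r N).filter (fun α => p.1 <+: α.drop j), ‖u α‖ ^ 2
      ≤ ∑ α ∈ words r N, ‖u α‖ ^ 2 :=
    Finset.sum_le_sum_of_subset_of_nonneg (Finset.filter_subset _ _) fun _ _ _ => sq_nonneg _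
  rw [← Finset.sum_filter, ← Finset.sum_div, Finset.sum_add_distrib] at h1
  linarith

/-- A substitution in the part before the cut moves the cut, and it is lost if the cut leaves
the window. -/
theorem sum_substForm_cut_left {q L R : ℕ} {p : Word r × Word r} (hp : p.1 ≠ []) {u : Word r → ℂ}
    (hu : ∀ α ∉ words r (q + R), u α = 0) (j : ℕ) :
    ∑ α₂ ∈ words r R, ∑ d ∈ Finset.range (q + L),
        substForm p j (q + L) (fun α₁ => cut q L u α₁ α₂ d)
      = (L : ℂ)⁻¹ * ∑ k ∈ Finset.Ico q (q + L),
          if j + p.1.length ≤ k ∧ q + p.1.length ≤ k + p.2.length ∧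
            k + p.2.length < q + L + p.1.length
          then substForm p j (q + R) u else 0 := by
  classical
  have h := sum_isCut q L R (fun α₁ α₂ d => if p.1 <+: α₁.drop j then
    starRingEnd ℂ (cut q L u (replace p.1 p.2 j α₁) α₂ d) * ((√(L : ℝ) : ℂ)⁻¹ * u (α₁ ++ α₂))
    else 0) (fun α₁ α₂ _ h => by simp [hu _ h])
  have hl : ∑ α₂ ∈ words r R, ∑ d ∈ Finset.range (q + L),
        substForm p j (q + L) (fun α₁ => cut q L u α₁ α₂ d)
      = ∑ α₁ ∈ words r (q + L), ∑ α₂ ∈ words r R, ∑ d ∈ Finset.range (q + L),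
      if IsCut q L α₁ α₂ d then (if p.1 <+: α₁.drop j then
        starRingEnd ℂ (cut q L u (replace p.1 p.2 j α₁) α₂ d) *
          ((√(L : ℝ) : ℂ)⁻¹ * u (α₁ ++ α₂)) else 0) else 0 := by
    rw [Finset.sum_comm (s := words r (q + L))]
    refine Finset.sum_congr rfl fun α₂ _ => ?_
    rw [Finset.sum_comm (s := words r (q + L))]
    refine Finset.sum_congr rfl fun d _ => Finset.sum_congr rfl fun α₁ _ => ?_
    by_cases h : IsCut q L α₁ α₂ d
    · simp only [if_pos h]
      congr 2
      rw [cut, if_pos h]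
    · simp [cut, h]
  rw [hl, h, Finset.sum_comm, Finset.mul_sum]
  refine Finset.sum_congr rfl fun k hk => ?_
  rw [Finset.mem_Ico] at hk
  have key : ∀ α : Word r, (if p.1 <+: (α.take k).drop j then
      starRingEnd ℂ (cut q L u (replace p.1 p.2 j (α.take k)) (α.drop k) (k - α.length)) *
        ((√(L : ℝ) : ℂ)⁻¹ * u (α.take k ++ α.drop k)) else 0)
      = if j + p.1.length ≤ k ∧ q + p.1.length ≤ k + p.2.length ∧
            k + p.2.length < q + L + p.1.length then
          (L : ℂ)⁻¹ * (if p.1 <+: α.drop j then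
            starRingEnd ℂ (u (replace p.1 p.2 j α)) * u α else 0) else 0 := by
    intro α
    by_cases h1 : p.1 <+: (α.take k).drop j
    · rw [if_pos h1]
      obtain ⟨h2, h3⟩ := (prefix_drop_take_iff hp).mp h1
      have hlen := length_replace (γ := p.2) hp h1
      rw [List.length_take] at hlen
      have hcut : IsCut q L (replace p.1 p.2 j (α.take k)) (α.drop k) (k - α.length) ↔
          j + p.1.length ≤ k ∧ q + p.1.length ≤ k + p.2.length ∧
            k + p.2.length < q + L + p.1.length := by
        simp only [IsCut, List.drop_eq_nil_iff]
        omega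
      unfold cut
      simp only [hcut, h2, if_true, List.take_append_drop, replace_take_append_drop h3]
      split_ifs
      · rw [map_mul, map_inv₀, Complex.conj_ofReal, ← inv_sqrt_mul_self]
        ring
      · simp
    · rw [if_neg h1]
      rw [prefix_drop_take_iff hp] at h1
      split_ifs with h2 h3
      · exact absurd ⟨h3, h2.1⟩ h1
      · simp
      · rfl
  simp only [key]
  split_ifs
  · rw [substForm, Finset.mul_sum]
  · simp

/-- A substitution in the part after the cut does not move the cut. -/
theorem sum_substForm_cut_right {q L R : ℕ} {p : Word r × Word r} (hp : p.1 ≠ []) {u : Word r → ℂ}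
    (hu : ∀ α ∉ words r (q + R), u α = 0) (j : ℕ) :
    ∑ α₁ ∈ words r (q + L), ∑ d ∈ Finset.range (q + L),
        substForm p j R (fun α₂ => cut q L u α₁ α₂ d)
      = (L : ℂ)⁻¹ * ∑ k ∈ Finset.Ico q (q + L), substForm p (k + j) (q + R) u := by
  classical
  have h := sum_isCut q L R (fun α₁ α₂ d => if p.1 <+: α₂.drop j then
    starRingEnd ℂ (cut q L u α₁ (replace p.1 p.2 j α₂) d) * ((√(L : ℝ) : ℂ)⁻¹ * u (α₁ ++ α₂))
    else 0) (fun α₁ α₂ _ h => by simp [hu _ h])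
  have hl : ∑ α₁ ∈ words r (q + L), ∑ d ∈ Finset.range (q + L),
        substForm p j R (fun α₂ => cut q L u α₁ α₂ d)
      = ∑ α₁ ∈ words r (q + L), ∑ α₂ ∈ words r R, ∑ d ∈ Finset.range (q + L),
      if IsCut q L α₁ α₂ d then (if p.1 <+: α₂.drop j then
        starRingEnd ℂ (cut q L u α₁ (replace p.1 p.2 j α₂) d) *
          ((√(L : ℝ) : ℂ)⁻¹ * u (α₁ ++ α₂)) else 0) else 0 := by
    refine Finset.sum_congr rfl fun α₁ _ => ?_
    rw [Finset.sum_comm (s := words r R)]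
    refine Finset.sum_congr rfl fun d _ => Finset.sum_congr rfl fun α₂ _ => ?_
    by_cases h : IsCut q L α₁ α₂ d
    · simp only [if_pos h]
      congr 2
      rw [cut, if_pos h]
    · simp [cut, h]
  rw [hl, h, Finset.sum_comm, Finset.mul_sum]
  refine Finset.sum_congr rfl fun k hk => ?_
  rw [Finset.mem_Ico] at hk
  rw [substForm, Finset.mul_sum]
  refine Finset.sum_congr rfl fun α _ => ?_
  rw [List.drop_drop]
  split_ifs with h1
  · have hlen := lt_length_of_prefix_drop hp h1
    have hcut : IsCut q L (α.take k) (replace p.1 p.2 j (α.drop k)) (k - α.length) := by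
      simp only [IsCut, List.length_take]
      omega
    rw [cut, if_pos hcut, take_append_replace_drop, List.take_append_drop, map_mul, map_inv₀,
      Complex.conj_ofReal, ← inv_sqrt_mul_self]
    ring
  · simp

/-! ### Energy lost by cutting -/

/-- Number of places of a window at which the cut is lost by a change of the length of the
part before it. -/
theorem card_window_exits_le (q L a b : ℕ) :
    ((Finset.Ico q (q + L)).filter fun k => ¬ (q + a ≤ k + b ∧ k + b < q + L + a)).card
      ≤ a + b := by
  have hsub : ((Finset.Ico q (q + L)).filter fun k => ¬ (q + a ≤ k + b ∧ k + b < q + L + a))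
      ⊆ Finset.Ico q (q + a) ∪ Finset.Ico (q + L - b) (q + L) := by
    intro k hk
    simp only [Finset.mem_filter, Finset.mem_Ico, Finset.mem_union] at hk ⊢
    omega
  refine (Finset.card_le_card hsub).trans ((Finset.card_union_le _ _).trans ?_)
  simp only [Nat.card_Ico]
  omega

/-- Cutting nearly preserves the quadratic form: only the substitutions that straddle the cut or
push it out of the window are lost, and averaging over the window makes them few. -/
theorem norm_sum_substForm_sub_cut_le {q L R : ℕ} (hL : 0 < L) {p : Word r × Word r}
    (hp : p.1 ≠ []) {u : Word r → ℂ} (hu : ∀ α ∉ words r (q + R), u α = 0) :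
    ‖∑ j ∈ Finset.range (q + R), substForm p j (q + R) u
      - (∑ j ∈ Finset.range (q + L), ∑ α₂ ∈ words r R, ∑ d ∈ Finset.range (q + L),
          substForm p j (q + L) (fun α₁ => cut q L u α₁ α₂ d)
        + ∑ j ∈ Finset.range R, ∑ α₁ ∈ words r (q + L), ∑ d ∈ Finset.range (q + L),
          substForm p j R (fun α₂ => cut q L u α₁ α₂ d))‖
      ≤ 2 * (p.1.length + p.2.length : ℕ) * ((q + L : ℕ) / L : ℝ) *
        ∑ α ∈ words r (q + R), ‖u α‖ ^ 2 := by
  classical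
  set B : ℕ → ℂ := fun j => substForm p j (q + R) u with hB
  set S : ℝ := ∑ α ∈ words r (q + R), ‖u α‖ ^ 2 with hS
  have hS0 : 0 ≤ S := Finset.sum_nonneg fun _ _ => sq_nonneg _
  have hB0 : ∀ j, q + R ≤ j → B j = 0 := fun j hj => substForm_eq_zero hp hj u
  have hBS : ∀ j, ‖B j‖ ≤ S := fun j => norm_substForm_le hp j hu
  have hL' : (L : ℂ) ≠ 0 := by exact_mod_cast hL.ne'
  have hδ : 0 < p.1.length := List.length_pos_iff.mpr hp
  set M := q + L + R with hM
  set W := Finset.Ico q (q + L) with hW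
  have hWcard : W.card = L := by simp [hW]
  -- The substitution at place `j` lies before the cut `k` and keeps it inside the window.
  let C : ℕ → ℕ → Prop := fun k j => j + p.1.length ≤ k ∧ q + p.1.length ≤ k + p.2.length ∧
    k + p.2.length < q + L + p.1.length
  -- All three sums become averages over the place `k` of the cut, with the same range of `j`.
  have e1 : ∑ j ∈ Finset.range (q + R), B j = (L : ℂ)⁻¹ * ∑ k ∈ W, ∑ j ∈ Finset.range M, B j := by
    rw [Finset.sum_const, hWcard, nsmul_eq_mul, inv_mul_cancel_left₀ hL']
    refine Finset.sum_subset (Finset.range_subset_range.mpr (by omega)) fun j _ hj => hB0 j ?_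
    simpa using hj
  have e2 : ∑ j ∈ Finset.range (q + L), ∑ α₂ ∈ words r R, ∑ d ∈ Finset.range (q + L),
        substForm p j (q + L) (fun α₁ => cut q L u α₁ α₂ d)
      = (L : ℂ)⁻¹ * ∑ k ∈ W, ∑ j ∈ Finset.range M, if C k j then B j else 0 := by
    simp only [sum_substForm_cut_left hp hu]
    rw [← Finset.mul_sum, Finset.sum_comm]
    congr 1
    refine Finset.sum_congr rfl fun k hk => ?_
    refine Finset.sum_subset (Finset.range_subset_range.mpr (by omega)) fun j _ hj => if_neg ?_
    rw [Finset.mem_Ico] at hk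
    rw [Finset.mem_range] at hj
    omega
  have e3 : ∑ j ∈ Finset.range R, ∑ α₁ ∈ words r (q + L), ∑ d ∈ Finset.range (q + L),
        substForm p j R (fun α₂ => cut q L u α₁ α₂ d)
      = (L : ℂ)⁻¹ * ∑ k ∈ W, ∑ j ∈ Finset.range M, if k ≤ j then B j else 0 := by
    simp only [sum_substForm_cut_right hp hu]
    rw [← Finset.mul_sum, Finset.sum_comm]
    congr 1
    refine Finset.sum_congr rfl fun k hk => ?_
    rw [Finset.mem_Ico] at hk
    have h1 : ∑ j ∈ Finset.range R, B (k + j) = ∑ j ∈ Finset.Ico k (k + R), B j := by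
      rw [Finset.sum_Ico_eq_sum_range, Nat.add_sub_cancel_left]
    rw [h1, ← Finset.sum_filter]
    refine Finset.sum_subset ?_ fun j hj hj' => hB0 j ?_
    · intro j hj
      simp only [Finset.mem_filter, Finset.mem_range, Finset.mem_Ico] at hj ⊢
      omega
    · simp only [Finset.mem_filter, Finset.mem_range, Finset.mem_Ico] at hj hj'
      omega
  rw [e1, e2, e3, ← mul_add, ← mul_sub, ← Finset.sum_add_distrib, ← Finset.sum_sub_distrib]
  simp only [← Finset.sum_add_distrib, ← Finset.sum_sub_distrib]
  -- The substitution pushes the cut `k` out of the window.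
  let Out : ℕ → Prop := fun k =>
    ¬ (q + p.1.length ≤ k + p.2.length ∧ k + p.2.length < q + L + p.1.length)
  have key : ∀ k ∈ W, ‖∑ j ∈ Finset.range M,
      (B j - ((if C k j then B j else 0) + if k ≤ j then B j else 0))‖
      ≤ (p.1.length + if Out k then ((q + L : ℕ) : ℝ) else 0) * S := by
    intro k hk
    rw [hW, Finset.mem_Ico] at hk
    have h1 : ∀ j ∈ Finset.range M,
        ‖B j - ((if C k j then B j else 0) + if k ≤ j then B j else 0)‖
        ≤ (if j < k ∧ k < j + p.1.length then S else 0) + if j < k ∧ Out k then S else 0 := by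
      intro j _
      by_cases hkj : k ≤ j
      · have hC : ¬ C k j := fun h => by have := h.1; omega
        rw [if_neg hC, if_pos hkj, zero_add, sub_self, norm_zero]
        split_ifs <;> linarith
      · rw [if_neg hkj, add_zero]
        have hBj := hBS j
        by_cases hC : C k j
        · rw [if_pos hC, sub_self, norm_zero]
          split_ifs <;> linarith
        · rw [if_neg hC, sub_zero]
          by_cases ho : Out k
          · rw [if_pos (⟨by omega, ho⟩ : j < k ∧ Out k)]
            split_ifs <;> linarith
          · have h2 : k < j + p.1.length := by
              by_contra h3
              exact hC ⟨by omega, not_not.mp ho⟩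
            rw [if_pos (⟨by omega, h2⟩ : j < k ∧ k < j + p.1.length)]
            split_ifs <;> linarith
    refine (norm_sum_le _ _).trans ((Finset.sum_le_sum h1).trans ?_)
    rw [Finset.sum_add_distrib, add_mul, ← Finset.sum_filter, ← Finset.sum_filter,
      Finset.sum_const, Finset.sum_const, nsmul_eq_mul, nsmul_eq_mul]
    refine add_le_add (mul_le_mul_of_nonneg_right ?_ hS0) (mul_le_mul_of_nonneg_right ?_ hS0)
    · have hsub : (Finset.range M).filter (fun j => j < k ∧ k < j + p.1.length)
          ⊆ Finset.Ico (k - p.1.length) k := by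
        intro j hj
        simp only [Finset.mem_filter, Finset.mem_Ico] at hj ⊢
        omega
      have := Finset.card_le_card hsub
      rw [Nat.card_Ico] at this
      exact_mod_cast (by omega : _ ≤ p.1.length)
    · split_ifs with ho
      · have hsub : (Finset.range M).filter (fun j => j < k ∧ Out k)
            ⊆ Finset.range (q + L) := by
          intro j hj
          simp only [Finset.mem_filter, Finset.mem_range] at hj ⊢
          omega
        have := Finset.card_le_card hsub
        rw [Finset.card_range] at this
        exact_mod_cast this
      · simp [ho]
  rw [norm_mul, norm_inv, Complex.norm_natCast]
  have hLpos : (0 : ℝ) < L := by exact_mod_cast hL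
  rw [inv_mul_le_iff₀ hLpos]
  refine (norm_sum_le _ _).trans ((Finset.sum_le_sum key).trans ?_)
  rw [← Finset.sum_mul, Finset.sum_add_distrib, Finset.sum_const, hWcard, ← Finset.sum_filter,
    Finset.sum_const, nsmul_eq_mul, nsmul_eq_mul]
  have hout : (((W.filter Out).card : ℕ) : ℝ) ≤ (p.1.length + p.2.length : ℕ) := by
    exact_mod_cast card_window_exits_le q L p.1.length p.2.length
  have hrhs : (L : ℝ) * (2 * (p.1.length + p.2.length : ℕ) * ((q + L : ℕ) / L : ℝ) * S)
      = 2 * (p.1.length + p.2.length : ℕ) * (q + L : ℕ) * S := by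
    field_simp
  rw [hrhs]
  refine mul_le_mul_of_nonneg_right ?_ hS0
  have h5 : (L : ℝ) ≤ (q + L : ℕ) := by exact_mod_cast (by omega : L ≤ q + L)
  have h6 : (p.1.length : ℝ) ≤ (p.1.length + p.2.length : ℕ) := by
    exact_mod_cast (by omega : p.1.length ≤ p.1.length + p.2.length)
  have h7 : (L : ℝ) * p.1.length ≤ (q + L : ℕ) * (p.1.length + p.2.length : ℕ) :=
    mul_le_mul h5 h6 (Nat.cast_nonneg _) (Nat.cast_nonneg _)
  have h8 := mul_le_mul_of_nonneg_right hout (Nat.cast_nonneg (α := ℝ) (q + L))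
  linarith

namespace SymmetricGrammar

variable (G : SymmetricGrammar r)

/-- The coupling constants weighted with the lengths of the words of the substitutions: it bounds
the change of the energy by cutting. -/
def cutConst : ℝ := ∑ p ∈ G.sub, ‖G.coeff p‖ * (2 * (p.1.length + p.2.length : ℕ))

theorem cutConst_nonneg : 0 ≤ G.cutConst :=
  Finset.sum_nonneg fun _ _ => mul_nonneg (norm_nonneg _) (by positivity)

theorem norm_form_sub_cut_le {q L R : ℕ} (hL : 0 < L) {u : Word r → ℂ}
    (hu : ∀ α ∉ words r (q + R), u α = 0) :
    ‖G.form (q + R) u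
      - (∑ α₂ ∈ words r R, ∑ d ∈ Finset.range (q + L),
          G.form (q + L) (fun α₁ => cut q L u α₁ α₂ d)
        + ∑ α₁ ∈ words r (q + L), ∑ d ∈ Finset.range (q + L),
          G.form R (fun α₂ => cut q L u α₁ α₂ d))‖
      ≤ G.cutConst * ((q + L : ℕ) / L : ℝ) * ∑ α ∈ words r (q + R), ‖u α‖ ^ 2 := by
  have hpull : ∀ (s : Finset (Word r)) (n N : ℕ) (f : Word r → ℕ → Word r → ℂ),
      ∑ α ∈ s, ∑ d ∈ Finset.range n, G.form N (f α d)
      = ∑ p ∈ G.sub, G.coeff p * ∑ j ∈ Finset.range N, ∑ α ∈ s, ∑ d ∈ Finset.range n,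
          substForm p j N (f α d) := by
    intro s n N f
    unfold form
    calc _ = ∑ α ∈ s, ∑ p ∈ G.sub, ∑ d ∈ Finset.range n,
          G.coeff p * ∑ j ∈ Finset.range N, substForm p j N (f α d) :=
          Finset.sum_congr rfl fun α _ => Finset.sum_comm
      _ = ∑ p ∈ G.sub, ∑ α ∈ s, ∑ d ∈ Finset.range n,
          G.coeff p * ∑ j ∈ Finset.range N, substForm p j N (f α d) := Finset.sum_comm
      _ = _ := by
        refine Finset.sum_congr rfl fun p _ => ?_
        simp only [← Finset.mul_sum]
        congr 1
        rw [Finset.sum_comm (s := Finset.range N)]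
        exact Finset.sum_congr rfl fun α _ => Finset.sum_comm
  rw [hpull, hpull, form, ← Finset.sum_add_distrib, ← Finset.sum_sub_distrib, cutConst,
    Finset.sum_mul, Finset.sum_mul]
  refine (norm_sum_le _ _).trans (Finset.sum_le_sum fun p hp => ?_)
  rw [← mul_add, ← mul_sub, norm_mul, mul_assoc, mul_assoc]
  refine mul_le_mul_of_nonneg_left ?_ (norm_nonneg _)
  have := norm_sum_substForm_sub_cut_le hL (G.nonempty p hp).1 hu
  rwa [mul_assoc] at this

end SymmetricGrammar

/-! ### Submultiplicativity of the partition function -/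

/-- Jensen's inequality for the exponential and a matrix `t` with column sums one and row sums at
most one. With `t i j = |⟨w_i, V u_j⟩|²` for an isometry `V` and eigenbases `u`, `w` of `C`, `A`
it becomes `Tr exp C ≤ exp b * Tr exp A` whenever `C ≤ b + V* A V`. -/
theorem sum_exp_le_of_le_sum_mul {ι κ : Type*} (s : Finset ι) [Fintype κ] (a : ι → ℝ) (c : κ → ℝ)
    (b : ℝ) (t : ι → κ → ℝ) (h0 : ∀ i j, 0 ≤ t i j) (h1 : ∀ j, ∑ i ∈ s, t i j = 1)
    (h2 : ∀ i ∈ s, ∑ j, t i j ≤ 1) (hc : ∀ j, c j ≤ b + ∑ i ∈ s, t i j * a i) :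
    ∑ j, Real.exp (c j) ≤ Real.exp b * ∑ i ∈ s, Real.exp (a i) := by
  have h3 : ∀ j, Real.exp (c j) ≤ Real.exp b * ∑ i ∈ s, t i j * Real.exp (a i) := by
    intro j
    refine (Real.exp_le_exp.mpr (hc j)).trans ?_
    rw [Real.exp_add]
    refine mul_le_mul_of_nonneg_left ?_ (Real.exp_pos b).le
    have := convexOn_exp.map_sum_le (t := s) (w := fun i => t i j) (p := a)
      (fun i _ => h0 i j) (h1 j) (fun _ _ => Set.mem_univ _)
    simpa only [smul_eq_mul] using this
  refine (Finset.sum_le_sum fun j _ => h3 j).trans ?_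
  rw [← Finset.mul_sum, Finset.sum_comm]
  refine mul_le_mul_of_nonneg_left (Finset.sum_le_sum fun i hi => ?_) (Real.exp_pos b).le
  rw [← Finset.sum_mul]
  exact mul_le_of_le_one_left (Real.exp_pos _).le (h2 i hi)

/-- The values of a contractive linear functional on an orthonormal basis have square sum at most
one. -/
theorem sum_norm_sq_le_one_of_contraction {ι E : Type*} [Fintype ι] [NormedAddCommGroup E]
    [InnerProductSpace ℂ E] (b : OrthonormalBasis ι ℂ E) (ℓ : E →ₗ[ℂ] ℂ)
    (hℓ : ∀ x, ‖ℓ x‖ ^ 2 ≤ ‖x‖ ^ 2) : ∑ i, ‖ℓ (b i)‖ ^ 2 ≤ 1 := by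
  classical
  -- The vector that represents the functional makes the bound sharp.
  set x : E := ∑ i, starRingEnd ℂ (ℓ (b i)) • b i with hx
  set s : ℝ := ∑ i, ‖ℓ (b i)‖ ^ 2 with hs
  have hs0 : 0 ≤ s := Finset.sum_nonneg fun _ _ => sq_nonneg _
  have h1 : ℓ x = (s : ℂ) := by
    rw [hx, hs, map_sum]
    push_cast
    refine Finset.sum_congr rfl fun i _ => ?_
    rw [map_smul, smul_eq_mul, Complex.conj_mul']
  have h2 : ‖x‖ ^ 2 = s := by
    rw [← b.sum_sq_norm_inner_right x]
    refine Finset.sum_congr rfl fun i _ => ?_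
    rw [hx, b.orthonormal.inner_right_fintype, RCLike.norm_conj]
  have h3 := hℓ x
  rw [h1, h2, Complex.norm_real, Real.norm_of_nonneg hs0] at h3
  nlinarith

theorem cut_add (q L : ℕ) (u v : Word r → ℂ) (α₁ α₂ : Word r) (d : ℕ) :
    cut q L (u + v) α₁ α₂ d = cut q L u α₁ α₂ d + cut q L v α₁ α₂ d := by
  unfold cut
  split_ifs
  · rw [Pi.add_apply, mul_add]
  · simp

theorem cut_smul (q L : ℕ) (c : ℂ) (u : Word r → ℂ) (α₁ α₂ : Word r) (d : ℕ) :
    cut q L (c • u) α₁ α₂ d = c * cut q L u α₁ α₂ d := by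
  unfold cut
  split_ifs
  · rw [Pi.smul_apply, smul_eq_mul, mul_left_comm]
  · simp

namespace SymmetricGrammar

variable (G : SymmetricGrammar r)

theorem amplitude_add (N : ℕ) (i) (f g : Word r → ℂ) :
    G.amplitude N i (fun α => f α + g α) = G.amplitude N i f + G.amplitude N i g := by
  simp only [amplitude, mul_add, Finset.sum_add_distrib]

theorem amplitude_mul (N : ℕ) (i) (c : ℂ) (f : Word r → ℂ) :
    G.amplitude N i (fun α => c * f α) = c * G.amplitude N i f := by
  simp only [amplitude, Finset.mul_sum]
  exact Finset.sum_congr rfl fun _ _ => mul_left_comm _ _ _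

/-- The amplitude of a function of the two parts of a word in the product of two eigenvectors. -/
def amplitude₂ (M N : ℕ) (i : Fin (Module.finrank ℂ (HilbN r M)))
    (i' : Fin (Module.finrank ℂ (HilbN r N))) (f : Word r → Word r → ℂ) : ℂ :=
  G.amplitude M i fun α₁ => G.amplitude N i' fun α₂ => f α₁ α₂

theorem amplitude₂_swap (M N : ℕ) (i i') (f : Word r → Word r → ℂ) :
    G.amplitude₂ M N i i' f = G.amplitude₂ N M i' i fun α₂ α₁ => f α₁ α₂ := by
  simp only [amplitude₂, amplitude, Finset.mul_sum]
  rw [Finset.sum_comm]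
  exact Finset.sum_congr rfl fun _ _ => Finset.sum_congr rfl fun _ _ => mul_left_comm _ _ _

theorem sum_norm_amplitude₂_sq_left (M N : ℕ) (i') (f : Word r → Word r → ℂ) :
    ∑ i, ‖G.amplitude₂ M N i i' f‖ ^ 2
      = ∑ α₁ ∈ words r M, ‖G.amplitude N i' (f α₁)‖ ^ 2 :=
  G.sum_norm_amplitude_sq M fun α₁ => G.amplitude N i' (f α₁)

theorem sum_norm_amplitude₂_sq (M N : ℕ) (f : Word r → Word r → ℂ) :
    ∑ i, ∑ i', ‖G.amplitude₂ M N i i' f‖ ^ 2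
      = ∑ α₁ ∈ words r M, ∑ α₂ ∈ words r N, ‖f α₁ α₂‖ ^ 2 := by
  rw [Finset.sum_comm]
  simp only [sum_norm_amplitude₂_sq_left]
  rw [Finset.sum_comm]
  exact Finset.sum_congr rfl fun α₁ _ => G.sum_norm_amplitude_sq N (f α₁)

theorem sum_level_right (M N : ℕ) {f : Word r → Word r → ℂ}
    (hf : ∀ α₁, ∀ α₂ ∉ words r N, f α₁ α₂ = 0) :
    ((∑ i, ∑ i', ‖G.amplitude₂ M N i i' f‖ ^ 2 * G.level N i' : ℝ) : ℂ)
      = ∑ α₁ ∈ words r M, G.form N (f α₁) := by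
  rw [Finset.sum_comm]
  simp only [← Finset.sum_mul, sum_norm_amplitude₂_sq_left]
  simp only [Finset.sum_mul]
  rw [Finset.sum_comm, Complex.ofReal_sum]
  refine Finset.sum_congr rfl fun α₁ _ => ?_
  rw [← G.sum_level_mul_norm_amplitude_sq N (hf α₁)]
  simp only [mul_comm]

theorem sum_level_left (M N : ℕ) {f : Word r → Word r → ℂ}
    (hf : ∀ α₁ ∉ words r M, ∀ α₂, f α₁ α₂ = 0) :
    ((∑ i, ∑ i', ‖G.amplitude₂ M N i i' f‖ ^ 2 * G.level M i : ℝ) : ℂ)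
      = ∑ α₂ ∈ words r N, G.form M (fun α₁ => f α₁ α₂) := by
  rw [← G.sum_level_right N M (f := fun α₂ α₁ => f α₁ α₂) fun α₂ α₁ h => hf α₁ h α₂,
    Finset.sum_comm]
  simp only [G.amplitude₂_swap M N _ _ f]

/-- The partition function as a real number. -/
def partition (β : ℝ) (N : ℕ) : ℝ := ∑ i, Real.exp (-β * G.level N i)

/-- Approximate submultiplicativity of the partition function. -/
theorem partition_add_le (β : ℝ) {q L : ℕ} (hL : 0 < L) (R : ℕ) :
    G.partition β (q + R) ≤ Real.exp (|β| * (G.cutConst * ((q + L : ℕ) / L : ℝ))) *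
      ((q + L : ℕ) * (G.partition β (q + L) * G.partition β R)) := by
  classical
  let s := (Finset.univ : Finset (Fin (Module.finrank ℂ (HilbN r (q + L))))) ×ˢ
    (Finset.univ : Finset (Fin (Module.finrank ℂ (HilbN r R)))) ×ˢ Finset.range (q + L)
  let u : Fin (Module.finrank ℂ (HilbN r (q + R))) → Word r → ℂ :=
    fun j => (G.eigenbasis (q + R) j : Hilb r)
  have hu : ∀ j, ∀ α ∉ words r (q + R), u j α = 0 := fun j α hα =>
    apply_eq_zero_of_mem_HilbN (G.eigenbasis (q + R) j).2 hα
  let T : Fin (Module.finrank ℂ (HilbN r (q + L))) × Fin (Module.finrank ℂ (HilbN r R)) × ℕ →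
      (Word r → ℂ) → ℂ :=
    fun i v => G.amplitude₂ (q + L) R i.1 i.2.1 fun α₁ α₂ => cut q L v α₁ α₂ i.2.2
  have hpars : ∀ v : Word r → ℂ, (∀ α ∉ words r (q + R), v α = 0) →
      ∑ i ∈ s, ‖T i v‖ ^ 2 = ∑ α ∈ words r (q + R), ‖v α‖ ^ 2 := by
    intro v hv
    rw [← sum_norm_cut_sq hL hv]
    simp only [s, T, Finset.sum_product]
    have h1 : ∀ i : Fin (Module.finrank ℂ (HilbN r (q + L))),
        ∑ i' : Fin (Module.finrank ℂ (HilbN r R)), ∑ d ∈ Finset.range (q + L),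
          ‖G.amplitude₂ (q + L) R i i' fun α₁ α₂ => cut q L v α₁ α₂ d‖ ^ 2
        = ∑ d ∈ Finset.range (q + L), ∑ i' : Fin (Module.finrank ℂ (HilbN r R)),
          ‖G.amplitude₂ (q + L) R i i' fun α₁ α₂ => cut q L v α₁ α₂ d‖ ^ 2 :=
      fun i => Finset.sum_comm
    simp only [h1]
    rw [Finset.sum_comm]
    simp only [sum_norm_amplitude₂_sq]
    rw [Finset.sum_comm]
    exact Finset.sum_congr rfl fun α₁ _ => Finset.sum_comm
  have hone : ∀ j, ∑ i ∈ s, ‖T i (u j)‖ ^ 2 = 1 := fun j => by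
    rw [hpars _ (hu j)]
    exact G.sum_norm_eigenbasis_sq _ j
  have hrow : ∀ i ∈ s, ∑ j, ‖T i (u j)‖ ^ 2 ≤ 1 := by
    intro i hi
    -- The rows are the values on the eigenbasis of a functional that Parseval makes contractive.
    let ℓ : HilbN r (q + R) →ₗ[ℂ] ℂ :=
      { toFun := fun x => T i (x : Hilb r)
        map_add' := fun x y => by
          simp only [T, amplitude₂, Submodule.coe_add, lp.coeFn_add, cut_add, amplitude_add]
        map_smul' := fun c x => by
          simp only [T, amplitude₂, Submodule.coe_smul, lp.coeFn_smul, cut_smul, amplitude_mul,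
            smul_eq_mul, RingHom.id_apply] }
    refine sum_norm_sq_le_one_of_contraction (G.eigenbasis (q + R)) ℓ fun x => ?_
    have hx : ∀ α ∉ words r (q + R), (x : Hilb r) α = 0 := fun α hα =>
      apply_eq_zero_of_mem_HilbN x.2 hα
    have h1 : ‖ℓ x‖ ^ 2 ≤ ∑ i ∈ s, ‖T i (x : Hilb r)‖ ^ 2 :=
      Finset.single_le_sum (f := fun i => ‖T i (x : Hilb r)‖ ^ 2) (fun _ _ => sq_nonneg _) hi
    refine h1.trans_eq ?_
    rw [hpars _ hx, ← G.sum_norm_amplitude_sq, ← OrthonormalBasis.sum_sq_norm_inner_right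
      (G.eigenbasis (q + R)) x]
    refine Finset.sum_congr rfl fun j _ => ?_
    rw [Submodule.coe_inner, inner_eq_sum (G.eigenbasis (q + R) j).2, amplitude]
  -- The mean energy of the two parts of a cut eigenvector is close to its eigenvalue.
  have henergy : ∀ j, |G.level (q + R) j
      - ∑ i ∈ s, ‖T i (u j)‖ ^ 2 * (G.level (q + L) i.1 + G.level R i.2.1)|
      ≤ G.cutConst * ((q + L : ℕ) / L : ℝ) := by
    intro j
    have h1 := G.norm_form_sub_cut_le hL (hu j)
    have h2 : G.form (q + R) (u j) = (G.level (q + R) j : ℂ) := by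
      rw [← G.inner_hamiltonian_self (G.eigenbasis (q + R) j).2, hamiltonian_eigenbasis,
        inner_smul_right, inner_self_eq_norm_sq_to_K]
      have h3 : ‖(G.eigenbasis (q + R) j : Hilb r)‖ = 1 := (G.eigenbasis (q + R)).orthonormal.1 j
      simp [h3]
    have h4 : (∑ α₂ ∈ words r R, ∑ d ∈ Finset.range (q + L),
          G.form (q + L) (fun α₁ => cut q L (u j) α₁ α₂ d)
        + ∑ α₁ ∈ words r (q + L), ∑ d ∈ Finset.range (q + L),
          G.form R (fun α₂ => cut q L (u j) α₁ α₂ d))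
        = ((∑ i ∈ s, ‖T i (u j)‖ ^ 2 * (G.level (q + L) i.1 + G.level R i.2.1) : ℝ) : ℂ) := by
      rw [Finset.sum_comm, Finset.sum_comm (s := words r (q + L))]
      simp only [← G.sum_level_left (q + L) R (f := fun α₁ α₂ => cut q L (u j) α₁ α₂ _)
        fun α₁ h α₂ => cut_eq_zero_of_left _ h _ _]
      simp only [← G.sum_level_right (q + L) R (f := fun α₁ α₂ => cut q L (u j) α₁ α₂ _)
        fun α₁ α₂ h => cut_eq_zero_of_right (hu j) _ h _]
      rw [← Complex.ofReal_sum, ← Complex.ofReal_sum, ← Complex.ofReal_add,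
        ← Finset.sum_add_distrib]
      congr 1
      simp only [s, T, Finset.sum_product, ← Finset.sum_add_distrib, ← mul_add]
      rw [Finset.sum_comm]
      exact Finset.sum_congr rfl fun i _ => Finset.sum_comm
    have h5 : ∑ α ∈ words r (q + R), ‖u j α‖ ^ 2 = 1 := G.sum_norm_eigenbasis_sq _ j
    rw [h4, h2, h5, mul_one, ← Complex.ofReal_sub, Complex.norm_real] at h1
    exact h1
  have hmain := sum_exp_le_of_le_sum_mul s
    (fun i => -β * G.level (q + L) i.1 + -β * G.level R i.2.1)
    (fun j => -β * G.level (q + R) j) (|β| * (G.cutConst * ((q + L : ℕ) / L : ℝ)))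
    (fun i j => ‖T i (u j)‖ ^ 2) (fun _ _ => sq_nonneg _) hone hrow ?_
  · refine hmain.trans_eq ?_
    rw [partition, partition, Finset.sum_mul_sum]
    simp only [s, Finset.sum_product, Finset.sum_const, Finset.card_range, Real.exp_add,
      nsmul_eq_mul, Finset.mul_sum]
  · intro j
    have h1 := mul_le_mul_of_nonneg_left (henergy j) (abs_nonneg β)
    rw [← abs_mul] at h1
    have h2 := (neg_le_abs _).trans h1
    have h3 : ∑ i ∈ s, ‖T i (u j)‖ ^ 2 * (-β * G.level (q + L) i.1 + -β * G.level R i.2.1)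
        = -β * ∑ i ∈ s, ‖T i (u j)‖ ^ 2 * (G.level (q + L) i.1 + G.level R i.2.1) := by
      rw [Finset.mul_sum]
      exact Finset.sum_congr rfl fun i _ => by ring
    rw [h3]
    linarith

end SymmetricGrammar

/-! ### Growth rates and the infinite volume limit -/

theorem tendsto_inv_natSqrt : Tendsto (fun n : ℕ => ((Nat.sqrt n : ℕ) : ℝ)⁻¹) atTop (𝓝 0) := by
  refine tendsto_inv_atTop_zero.comp (tendsto_natCast_atTop_atTop.comp ?_)
  refine tendsto_atTop.mpr fun b => ?_
  filter_upwards [eventually_ge_atTop (b * b)] with n hn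
  exact Nat.le_sqrt.mpr hn

theorem tendsto_natSqrt_div : Tendsto (fun n : ℕ => ((Nat.sqrt n : ℕ) : ℝ) / n) atTop (𝓝 0) := by
  refine squeeze_zero (fun n => by positivity) (fun n => ?_) tendsto_inv_natSqrt
  rcases Nat.eq_zero_or_pos n with rfl | hn
  · simp
  · have h1 : 0 < Nat.sqrt n := Nat.sqrt_pos.mpr hn
    have h2 : ((Nat.sqrt n : ℕ) : ℝ) * (Nat.sqrt n : ℕ) ≤ n := by exact_mod_cast Nat.sqrt_le n
    rw [div_le_iff₀ (by exact_mod_cast hn), inv_mul_eq_div, le_div_iff₀ (by exact_mod_cast h1)]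
    exact h2

/-- A sequence that is subadditive up to an overlap `L` and an error that is small for
`L` and `(q + L) / L` large grows linearly. The overlap is chosen as the square root. -/
theorem exists_tendsto_div_of_subadditive_overlap {F : ℕ → ℝ} {B : ℝ} (hB : 0 ≤ B)
    (hF0 : ∀ n, 0 ≤ F n)
    (hF : ∀ q L R : ℕ, 0 < L →
      F (q + R) ≤ B * ((q + L : ℕ) / L : ℝ) + Real.log (q + L : ℕ) + F (q + L) + F R) :
    ∃ c, Tendsto (fun n : ℕ => F n / n) atTop (𝓝 c) := by
  -- Increasing the argument by `Q m = m - √m` increases `F` by at most `E m`; the limit is the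
  -- infimum of `E m / Q m`.
  let E : ℕ → ℝ := fun m => B * ((m : ℕ) / (Nat.sqrt m : ℕ) : ℝ) + Real.log (m : ℕ) + F m
  let Q : ℕ → ℕ := fun m => m - Nat.sqrt m
  have hE0 : ∀ m, 0 ≤ E m := fun m =>
    add_nonneg (add_nonneg (mul_nonneg hB (by positivity)) (Real.log_natCast_nonneg m)) (hF0 m)
  have hQ : ∀ m, 4 ≤ m → 0 < Q m := fun m hm =>
    Nat.sub_pos_of_lt (Nat.sqrt_lt_self (by omega))
  have hstep : ∀ m, 4 ≤ m → ∀ R, F (Q m + R) ≤ E m + F R := by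
    intro m hm R
    have h := hF (Q m) (Nat.sqrt m) R (Nat.sqrt_pos.mpr (by omega))
    rwa [show Q m + Nat.sqrt m = m from Nat.sub_add_cancel (Nat.sqrt_le_self m)] at h
  have hiter : ∀ m, 4 ≤ m → ∀ t R : ℕ, F (Q m * t + R) ≤ t * E m + F R := by
    intro m hm t R
    induction t with
    | zero => simp
    | succ t ih =>
      have h := hstep m hm (Q m * t + R)
      rw [show Q m * (t + 1) + R = Q m + (Q m * t + R) by ring]
      push_cast
      linarith
  let c : ℝ := sInf ((fun m => E m / Q m) '' Set.Ici 4)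
  have hbdd : BddBelow ((fun m => E m / Q m) '' Set.Ici 4) :=
    ⟨0, by rintro _ ⟨m, -, rfl⟩; exact div_nonneg (hE0 m) (Nat.cast_nonneg _)⟩
  refine ⟨c, tendsto_order.mpr ⟨fun a ha => ?_, fun b hb => ?_⟩⟩
  · have hlim : Tendsto (fun n : ℕ => c * (1 - ((Nat.sqrt n : ℕ) : ℝ) / n)
        - (B * ((Nat.sqrt n : ℕ) : ℝ)⁻¹ + Real.log n / n)) atTop (𝓝 c) := by
      have hlog : Tendsto (fun n : ℕ => Real.log n / n) atTop (𝓝 0) :=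
        (Real.isLittleO_log_id_atTop.tendsto_div_nhds_zero).comp tendsto_natCast_atTop_atTop
      have := ((tendsto_natSqrt_div.const_sub 1).const_mul c).sub
        ((tendsto_inv_natSqrt.const_mul B).add hlog)
      simpa using this
    filter_upwards [hlim.eventually_const_lt ha, eventually_ge_atTop 4] with n hn h4
    refine hn.trans_le ?_
    have hc : c ≤ E n / Q n := csInf_le hbdd ⟨n, h4, rfl⟩
    have hn0 : (0 : ℝ) < n := by exact_mod_cast (by omega : 0 < n)
    have hq0 : (0 : ℝ) < Q n := by exact_mod_cast hQ n h4
    have hs0 : (0 : ℝ) < (Nat.sqrt n : ℕ) := by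
      exact_mod_cast Nat.sqrt_pos.mpr (by omega : 0 < n)
    have hQn : (Q n : ℝ) = n - (Nat.sqrt n : ℕ) := Nat.cast_sub (Nat.sqrt_le_self n)
    rw [le_div_iff₀ hq0, hQn] at hc
    rw [le_div_iff₀ hn0]
    have e1 : (c * (1 - ((Nat.sqrt n : ℕ) : ℝ) / n)
        - (B * ((Nat.sqrt n : ℕ) : ℝ)⁻¹ + Real.log n / n)) * n
        = c * (n - (Nat.sqrt n : ℕ)) - (B * (n / (Nat.sqrt n : ℕ)) + Real.log n) := by
      field_simp
    rw [e1]
    simp only [E] at hc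
    linarith
  · obtain ⟨_, ⟨m, hm, rfl⟩, hmb⟩ := exists_lt_of_csInf_lt (Set.Nonempty.image _ ⟨4, le_refl 4⟩) hb
    have hm4 : 4 ≤ m := hm
    have hq0 : (0 : ℝ) < Q m := by exact_mod_cast hQ m hm4
    let K : ℝ := ∑ i ∈ Finset.range (Q m), F i
    have hlim : Tendsto (fun n : ℕ => E m / Q m + K / n) atTop (𝓝 (E m / Q m + 0)) :=
      (tendsto_const_div_atTop_nhds_zero_nat K).const_add _
    rw [add_zero] at hlim
    filter_upwards [hlim.eventually_lt_const hmb, eventually_gt_atTop 0] with n hn h0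
    refine lt_of_le_of_lt ?_ hn
    have hn0 : (0 : ℝ) < n := by exact_mod_cast h0
    have h1 := hiter m hm4 (n / Q m) (n % Q m)
    rw [Nat.div_add_mod] at h1
    have h2 : F (n % Q m) ≤ K :=
      Finset.single_le_sum (fun i _ => hF0 i) (Finset.mem_range.mpr (Nat.mod_lt _ (hQ m hm4)))
    have h3 : ((n / Q m : ℕ) : ℝ) * E m ≤ n / Q m * E m :=
      mul_le_mul_of_nonneg_right Nat.cast_div_le (hE0 m)
    rw [div_le_iff₀ hn0, add_mul, div_mul_cancel₀ _ hn0.ne']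
    have e2 : E m / Q m * n = n / Q m * E m := by ring
    linarith

theorem pow_le_card_words (r N : ℕ) : r ^ N ≤ (words r N).card := by
  have h : ((Finset.univ : Finset (Fin N → Fin r))).card ≤ (words r N).card :=
    Finset.card_le_card_of_injOn List.ofFn (fun f _ => by simp [mem_words])
      List.ofFn_injective.injOn
  simpa using h

theorem finrank_HilbN (r N : ℕ) : Module.finrank ℂ (HilbN r N) = (words r N).card := by
  set b := stdOrthonormalBasis ℂ (HilbN r N)
  -- Both sides are the sum of `|⟨e_α, b_i⟩|²` over all `α` and `i`.
  have h1 : ∀ α ∈ words r N, ∑ i, ‖(b i : Hilb r) α‖ ^ 2 = 1 := by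
    intro α hα
    have h := b.sum_sq_norm_inner_left ⟨e α, e_mem_HilbN hα⟩
    simpa only [Submodule.coe_inner, inner_e_left, Submodule.coe_norm, norm_e, one_pow] using h
  have h2 : ∑ i, ∑ α ∈ words r N, ‖(b i : Hilb r) α‖ ^ 2 = Module.finrank ℂ (HilbN r N) := by
    have h3 : ∀ i, ‖(b i : Hilb r)‖ = 1 := fun i => b.orthonormal.1 i
    simp [sum_norm_sq_of_mem_HilbN (b _).2, h3]
  rw [Finset.sum_comm, Finset.sum_congr rfl h1] at h2
  simp only [Finset.sum_const, nsmul_eq_mul, mul_one] at h2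
  exact_mod_cast h2.symm

namespace SymmetricGrammar

variable (G : SymmetricGrammar r)

theorem partition_ge (β : ℝ) (N : ℕ) :
    (r : ℝ) ^ N * Real.exp (-(|β| * G.coupling * N)) ≤ G.partition β N := by
  have h1 : ∀ i, Real.exp (-(|β| * G.coupling * N)) ≤ Real.exp (-β * G.level N i) := by
    intro i
    have h2 := mul_le_mul_of_nonneg_left (G.abs_level_le N i) (abs_nonneg β)
    rw [← abs_mul] at h2
    have h3 := le_abs_self (β * G.level N i)
    refine Real.exp_le_exp.mpr ?_
    linarith
  have h2 := Finset.sum_le_sum fun i (_ : i ∈ Finset.univ) => h1 i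
  rw [Finset.sum_const, Finset.card_univ, Fintype.card_fin, nsmul_eq_mul] at h2
  refine le_trans (mul_le_mul_of_nonneg_right ?_ (Real.exp_pos _).le) h2
  rw [finrank_HilbN]
  exact_mod_cast pow_le_card_words r N

theorem partition_pos (hr : 0 < r) (β : ℝ) (N : ℕ) : 0 < G.partition β N :=
  lt_of_lt_of_le (mul_pos (pow_pos (by exact_mod_cast hr) _) (Real.exp_pos _)) (G.partition_ge β N)

theorem partitionFn_eq_partition (β : ℝ) (N : ℕ) :
    G.partitionFn β N = (G.partition β N : ℂ) := G.partitionFn_eq β N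

theorem mul_le_log_partition (hr : 0 < r) (β : ℝ) (N : ℕ) :
    (Real.log r - |β| * G.coupling) * N ≤ Real.log (G.partition β N) := by
  have hr' : (0 : ℝ) < r := by exact_mod_cast hr
  have h := Real.log_le_log (by positivity) (G.partition_ge β N)
  rw [Real.log_mul (pow_pos hr' _).ne' (Real.exp_pos _).ne', Real.log_pow, Real.log_exp] at h
  linarith

/-- The free energy per letter exists: `log Z_N / N` converges. -/
theorem exists_tendsto_log_partition_div (hr : 0 < r) {β : ℝ}
    (hβ : |β| * G.coupling ≤ Real.log r) :
    ∃ c, Tendsto (fun N : ℕ => Real.log (G.partition β N) / N) atTop (𝓝 c) := by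
  refine exists_tendsto_div_of_subadditive_overlap (B := |β| * G.cutConst)
    (mul_nonneg (abs_nonneg _) G.cutConst_nonneg) (fun N => ?_) fun q L R hL => ?_
  · exact (mul_nonneg (sub_nonneg.mpr hβ) (Nat.cast_nonneg N)).trans
      (G.mul_le_log_partition hr β N)
  · have hpos := G.partition_pos hr β
    have hqL : (0 : ℝ) < (q + L : ℕ) := by exact_mod_cast (by omega : 0 < q + L)
    have h := Real.log_le_log (hpos _) (G.partition_add_le β (q := q) hL R)
    rw [Real.log_mul (Real.exp_pos _).ne' (mul_pos hqL (mul_pos (hpos _) (hpos _))).ne',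
      Real.log_exp, Real.log_mul hqL.ne' (mul_pos (hpos _) (hpos _)).ne',
      Real.log_mul (hpos _).ne' (hpos _).ne'] at h
    linarith

theorem norm_gibbsOp_le (β : ℝ) (N : ℕ) :
    ‖G.gibbsOp β N‖ ≤ Real.exp (|β| * G.coupling * N) := by
  refine (norm_exp_le _).trans (Real.exp_le_exp.mpr ?_)
  rw [norm_smul, norm_neg, Complex.norm_real, Real.norm_eq_abs, mul_assoc]
  exact mul_le_mul_of_nonneg_left (G.norm_hamiltonian_le N) (abs_nonneg _)

end SymmetricGrammar

/-- The trace with a local operator involves only the finitely many basis vectors in its range. -/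
theorem norm_traceN_mul_le {M : ℕ} {A : Op r} (hA : IsInN M A) (N : ℕ) (B : Op r) :
    ‖traceN N (A * B)‖ ≤ (words r M).card * (‖A‖ * ‖B‖) := by
  classical
  have h1 : ∀ α : Word r, ‖inner ℂ (e α) ((A * B) (e α))‖
      ≤ if α ∈ words r M then ‖A‖ * ‖B‖ else 0 := by
    intro α
    split_ifs with hα
    · refine (norm_inner_le_norm _ _).trans ?_
      rw [norm_e, one_mul]
      refine ((A * B).le_opNorm _).trans ?_
      rw [norm_e, mul_one]
      exact norm_mul_le A B
    · have h2 : A (B (e α)) ∈ HilbN r M := by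
        rw [← hA]
        exact P_apply_mem M _
      rw [inner_e_left]
      change ‖(A (B (e α)) : Hilb r) α‖ ≤ 0
      rw [apply_eq_zero_of_mem_HilbN h2 hα, norm_zero]
  refine (norm_sum_le _ _).trans ((Finset.sum_le_sum fun α _ => h1 α).trans ?_)
  rw [← Finset.sum_filter, Finset.sum_const, nsmul_eq_mul]
  refine mul_le_mul_of_nonneg_right ?_ (by positivity)
  exact_mod_cast Finset.card_le_card fun α hα => (Finset.mem_filter.mp hα).2

theorem SymmetricGrammar.tendsto_gibbs_zero (G : SymmetricGrammar r) {β : ℝ}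
    (hr : 0 < r) (hβ : 2 * (|β| * G.coupling) < Real.log r) {A : Op r} (hA : A ∈ localAlgebra r) :
    Tendsto (fun N : ℕ => G.gibbs β N A) atTop (𝓝 0) := by
  obtain ⟨M, hM⟩ := hA
  have hr' : (0 : ℝ) < r := by exact_mod_cast hr
  set x := |β| * G.coupling with hx
  have hlim : Tendsto (fun N : ℕ => (words r M).card * ‖A‖ * (Real.exp (2 * x) / r) ^ N)
      atTop (𝓝 0) := by
    have h1 : Real.exp (2 * x) / r < 1 := by
      rw [div_lt_one hr', ← Real.lt_log_iff_exp_lt hr']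
      exact hβ
    simpa using (tendsto_pow_atTop_nhds_zero_of_lt_one (by positivity) h1).const_mul
      ((words r M).card * ‖A‖ : ℝ)
  refine squeeze_zero_norm (fun N => ?_) hlim
  have hpos := G.partition_pos hr β N
  rw [SymmetricGrammar.gibbs, norm_mul, norm_inv, G.partitionFn_eq_partition, Complex.norm_real,
    Real.norm_of_nonneg hpos.le, inv_mul_le_iff₀ hpos]
  refine (norm_traceN_mul_le hM N _).trans ?_
  rw [← mul_assoc]
  have h2 : (words r M).card * ‖A‖ * ‖G.gibbsOp β N‖
      ≤ (words r M).card * ‖A‖ * Real.exp (x * N) :=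
    mul_le_mul_of_nonneg_left (G.norm_gibbsOp_le β N) (by positivity)
  refine h2.trans ?_
  have h3 : Real.exp (x * N) = (r : ℝ) ^ N * Real.exp (-(x * N)) * (Real.exp (2 * x) / r) ^ N := by
    have h4 : Real.exp (x * N) = Real.exp (-(x * N)) * Real.exp (2 * x) ^ N := by
      rw [← Real.exp_nat_mul, ← Real.exp_add]
      ring_nf
    rw [h4, div_pow]
    field_simp
  have h5 := mul_le_mul_of_nonneg_right (G.partition_ge β N)
    (by positivity : 0 ≤ (Real.exp (2 * x) / r) ^ N)
  rw [← h3] at h5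
  rw [mul_left_comm (G.partition β N)]
  exact mul_le_mul_of_nonneg_left h5 (by positivity)

set_option synthInstance.maxHeartbeats 400000 in
theorem IsState.norm_apply_le {ω : quasilocalAlgebra r →ₗ[ℂ] ℂ} (hω : IsState ω)
    (a : quasilocalAlgebra r) : ‖ω a‖ ≤ ‖(a : Op r)‖ := by
  by_cases h0 : a = 0
  · simp [h0]
  have hpos : 0 < ‖(a : Op r)‖ := norm_pos_iff.mpr fun h => h0 (Subtype.ext h)
  have h1 : ‖ω (((‖(a : Op r)‖⁻¹ : ℝ) : ℂ) • a)‖ ≤ 1 := by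
    refine hω.2.1 ⟨_, ?_, rfl⟩
    change ‖((‖(a : Op r)‖⁻¹ : ℝ) : ℂ) • (a : Op r)‖ ≤ 1
    rw [norm_smul, Complex.norm_real, norm_inv, norm_norm, inv_mul_cancel₀ hpos.ne']
  rw [map_smul, norm_smul, Complex.norm_real, norm_inv, norm_norm, inv_mul_le_iff₀ hpos,
    mul_one] at h1
  exact h1

/-- No state vanishes on the local algebra, which is dense. -/
theorem IsState.exists_local_ne_zero {ω : quasilocalAlgebra r →ₗ[ℂ] ℂ} (hω : IsState ω) :
    ∃ (A : Op r) (hA : A ∈ localAlgebra r), ω ⟨A, local_le_quasilocal r hA⟩ ≠ 0 := by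
  by_contra! hloc
  have hzero : ∀ a : quasilocalAlgebra r, ω a = 0 := by
    intro a
    refine norm_le_zero_iff.mp (le_of_forall_pos_le_add fun ε hε => ?_)
    have ha : (a : Op r) ∈ closure (localAlgebra r : Set (Op r)) := a.2
    obtain ⟨A, hA, hdist⟩ := Metric.mem_closure_iff.mp ha ε hε
    have h1 := hω.norm_apply_le (a - ⟨A, local_le_quasilocal r hA⟩)
    rw [map_sub, hloc A hA, sub_zero] at h1
    rw [zero_add]
    refine h1.trans ?_
    rw [dist_eq_norm] at hdist
    exact hdist.le
  have h1 : (1 : ℝ) ≤ 0 := hω.2.2 (by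
    rintro _ ⟨a, -, rfl⟩
    simp [hzero a])
  linarith

end QuantumGrammar

end

theorem mainTheorem4 (r : ℕ) (hr : 2 ≤ r) (G : QuantumGrammar.SymmetricGrammar r) :
    ∃ β₀ : ℝ, 0 < β₀ ∧ ∀ β : ℝ, |β| < β₀ →
      (∀ N : ℕ, (G.partitionFn β N).im = 0 ∧ 0 < (G.partitionFn β N).re) ∧
      (∃ c : ℝ, 0 < c ∧ (3 ≤ r → 1 < c) ∧
        (fun N : ℕ => Real.log (G.partitionFn β N).re) ~[atTop] (fun N : ℕ => c * (N : ℝ))) ∧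
      (∀ A ∈ QuantumGrammar.localAlgebra r,
        Tendsto (fun N : ℕ => G.gibbs β N A) atTop (𝓝 0)) ∧
      (¬ ∃ ω : QuantumGrammar.quasilocalAlgebra r →ₗ[ℂ] ℂ, QuantumGrammar.IsState ω ∧
        ∀ (A : QuantumGrammar.Op r) (hA : A ∈ QuantumGrammar.localAlgebra r),
          Tendsto (fun N : ℕ => G.gibbs β N A) atTop
            (𝓝 (ω ⟨A, QuantumGrammar.local_le_quasilocal r hA⟩))) := by
  have hC := G.coupling_nonneg
  -- This makes `|β| ∑ |λ_i| < 1 / 100`, while `2 / 100 < log 2` and `1 + 1 / 100 < log 3`.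
  refine ⟨1 / (100 * (G.coupling + 1)), by positivity, fun β hβ => ?_⟩
  have hr0 : 0 < r := by omega
  have hx : |β| * G.coupling < 1 / 100 := by
    rw [lt_div_iff₀ (by positivity)] at hβ
    nlinarith [abs_nonneg β]
  have hlog2 : Real.log 2 ≤ Real.log r :=
    Real.log_le_log (by norm_num) (by exact_mod_cast hr)
  have hlog := Real.log_two_gt_d9
  have hgibbs : ∀ A ∈ QuantumGrammar.localAlgebra r,
      Tendsto (fun N : ℕ => G.gibbs β N A) atTop (𝓝 0) := fun A hA =>
    G.tendsto_gibbs_zero hr0 (by linarith) hA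
  have hre : ∀ N, (G.partitionFn β N).re = G.partition β N := fun N => by
    rw [G.partitionFn_eq_partition, Complex.ofReal_re]
  refine ⟨fun N => ⟨?_, ?_⟩, ?_, hgibbs, ?_⟩
  · rw [G.partitionFn_eq_partition, Complex.ofReal_im]
  · rw [hre]
    exact G.partition_pos hr0 β N
  · obtain ⟨c, hc⟩ := G.exists_tendsto_log_partition_div hr0 (β := β) (by linarith)
    have hcr : Real.log r - |β| * G.coupling ≤ c := by
      refine ge_of_tendsto hc ?_
      filter_upwards [eventually_gt_atTop 0] with N hN
      rw [le_div_iff₀ (by exact_mod_cast hN)]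
      exact G.mul_le_log_partition hr0 β N
    have hc0 : 0 < c := by linarith
    refine ⟨c, hc0, fun h3 => ?_, ?_⟩
    · have h1 : 1 + 1 / 100 ≤ Real.log r := by
        rw [Real.le_log_iff_exp_le (by exact_mod_cast hr0), Real.exp_add]
        have h4 : Real.exp (1 / 100) ≤ 1 / (1 - 1 / 100) :=
          Real.exp_bound_div_one_sub_of_interval (by norm_num) (by norm_num)
        have h5 : Real.exp 1 * Real.exp (1 / 100) ≤ 2.7182818286 * (1 / (1 - 1 / 100)) :=
          mul_le_mul Real.exp_one_lt_d9.le h4 (Real.exp_pos _).le (by norm_num)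
        have h6 : (3 : ℝ) ≤ r := by exact_mod_cast h3
        refine h5.trans (le_trans ?_ h6)
        norm_num
      linarith
    · simp only [hre]
      rw [isEquivalent_iff_tendsto_one]
      · have h := hc.div_const c
        rw [div_self hc0.ne'] at h
        refine h.congr fun N => ?_
        rw [Pi.div_apply, div_div, mul_comm]
      · filter_upwards [eventually_gt_atTop 0] with N hN
        exact mul_ne_zero hc0.ne' (by exact_mod_cast hN.ne')
  · rintro ⟨ω, hω, hlim⟩
    obtain ⟨A, hA, hne⟩ := hω.exists_local_ne_zero
    exact hne (tendsto_nhds_unique (hlim A hA) (hgibbs A hA))
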